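/- Let $K$ be a non-archimedean local field (a locally compact, non-discrete, totally disconnected field), let $dx$ be a Haar measure of $(K,+)$, and for $h\in K^*$ let $|h|$ be the factor with $d(hx)=|h|\,dx$. Let $G=K\rtimes K^*$ be the affine group, with the product topology of $K\times K^*$ and group law $(x,h)(y,k)=(hy+x,hk)$, and let $\pi$ be its quasi-regular representation on $L^2(K)$, $$(\pi(x,h)f)(y)=|h|^{-1/2}f\big(h^{-1}(y-x)\big).$$ For $f,g\in L^2(K)$ let $W_gf(s)=\langle f\,|\,\pi(s)g\rangle$, $s\in G$, be the wavelet transform, where $\langle f\,|\,g\rangle=\int_K f\,\overline g\,dx$. Let $\mathcal S_0(K)\subset L^2(K)$ be the space of (classes of) locally constant, compactly supported functions $\varphi:K\to\mathbb C$ with $\int_K\varphi\,dx=0$. For $R\subset G$ and $C>0$, the family $(\pi(r)g)_{r\in R}$ is a tight frame of $L^2(K)$ with frame constant $C$ if $\sum_{r\in R}|\langle u\,|\,\pi(r)g\rangle|^2=C\|u\|_2^2$ for all $u\in L^2(K)$. Let $0\neq g\in\mathcal S_0(K)$. Then, for every $f\in L^2(K)$, the following are equivalent: (a) $f\in\mathcal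 S_0(K)$. (b) $W_gf\in C_c(G)$, i.e. $W_gf$ is continuous and compactly supported on $G$. (c) For every compact open subgroup $H<G$, every set $R\subset G$ of representatives of the left cosets of $H$ (i.e. $G$ is the disjoint union of the sets $rH$, $r\in R$) and every $C>0$ such that $(\pi(r)g)_{r\in R}$ is a tight frame of $L^2(K)$ with frame constant $C$, the right-hand side of the frame reconstruction formula $$f=\frac1C\sum_{r\in R}W_gf(r)\,\pi(r)g$$ is a finite sum, i.e. has only finitely many nonzero terms. -/

import Mathlib

open MeasureTheory
open scoped NNReal ENNReal

/-- The affine group `K ⋊ Kˣ` of a field `K`: pairs `(x, h)` of a translation part `x ∈ K` and a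
dilation part `h ∈ Kˣ`, standing for the map `y ↦ h y + x`. -/
@[ext]
structure AffineGroup (K : Type*) [Field K] where
  trans : K
  dil : Kˣ

namespace AffineGroup

section Algebra

variable {K : Type*} [Field K]

/-- The group law `(x, h) (y, k) = (h y + x, h k)`. -/
instance : Mul (AffineGroup K) := ⟨fun s t => ⟨s.dil * t.trans + s.trans, s.dil * t.dil⟩⟩

instance : One (AffineGroup K) := ⟨⟨0, 1⟩⟩

instance : Inv (AffineGroup K) := ⟨fun s => ⟨-((s.dil⁻¹ : Kˣ) * s.trans), s.dil⁻¹⟩⟩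

theorem trans_mul (s t : AffineGroup K) : (s * t).trans = s.dil * t.trans + s.trans := rfl

theorem dil_mul (s t : AffineGroup K) : (s * t).dil = s.dil * t.dil := rfl

theorem trans_one : (1 : AffineGroup K).trans = 0 := rfl

theorem dil_one : (1 : AffineGroup K).dil = 1 := rfl

theorem trans_inv (s : AffineGroup K) : (s⁻¹).trans = -((s.dil⁻¹ : Kˣ) * s.trans) := rfl

theorem dil_inv (s : AffineGroup K) : (s⁻¹).dil = s.dil⁻¹ := rfl

instance : Group (AffineGroup K) :=
  Group.ofLeftAxioms
    (fun a b c => by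
      ext
      · simp only [trans_mul, dil_mul, Units.val_mul]; ring
      · simp only [dil_mul, mul_assoc])
    (fun a => by ext <;> simp [trans_mul, dil_mul, trans_one, dil_one])
    (fun a => by ext <;> simp [trans_mul, dil_mul, trans_inv, dil_inv, trans_one, dil_one])

/-- The topology of `K ⋊ Kˣ` is the product topology of `K × Kˣ`. -/
instance [TopologicalSpace K] : TopologicalSpace (AffineGroup K) :=
  TopologicalSpace.induced (fun s => (s.trans, s.dil)) inferInstance

end Algebra

end AffineGroup

section LocalField

variable {K : Type*} [Field K] [ValuativeRel K] [TopologicalSpace K] [IsNonarchimedeanLocalField K]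

/-- The absolute value `|h|` of `h ∈ Kˣ`: the factor by which multiplication by `h` scales every
Haar measure of `(K, +)`, that is `d(h x) = |h| dx`. -/
noncomputable def haarAbs (h : Kˣ) : ℝ≥0 := distribHaarChar K h

/-- The pointwise formula `(π(x, h) φ)(y) = |h|^{-1/2} φ(h⁻¹ (y - x))`. -/
noncomputable def quasiRegularFun (s : AffineGroup K) (φ : K → ℂ) (y : K) : ℂ :=
  (((haarAbs s.dil : ℝ) ^ (-(1 / 2) : ℝ) : ℝ) : ℂ) * φ ((s.dil⁻¹ : Kˣ) * (y - s.trans))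

variable [MeasurableSpace K] [BorelSpace K] (μ : Measure K) [μ.IsAddHaarMeasure] [μ.Regular]

open scoped Pointwise in
theorem map_affine_eq_smul (s : AffineGroup K) :
    μ.map (fun y : K => ((s.dil⁻¹ : Kˣ) : K) * (y - s.trans)) = haarAbs s.dil • μ := by
  have h1 : (fun y : K => ((s.dil⁻¹ : Kˣ) : K) * (y - s.trans))
      = (fun y : K => ((s.dil⁻¹ : Kˣ) : K) * y) ∘ (fun y => y + -s.trans) := by
    funext y; simp [sub_eq_add_neg]
  have hm : Measurable fun y : K => ((s.dil⁻¹ : Kˣ) : K) * y :=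
    (continuous_const_mul _).measurable
  have ha : Measurable fun y : K => y + -s.trans := (continuous_add_const _).measurable
  rw [h1, ← Measure.map_map hm ha, map_add_right_eq_self]
  ext S hS
  rw [Measure.map_apply hm hS, Measure.smul_apply]
  have h2 : (fun y : K => ((s.dil⁻¹ : Kˣ) : K) * y) ⁻¹' S = s.dil • S := by
    rw [← Set.preimage_smul_inv]; rfl
  rw [h2, ← distribHaarChar_mul μ s.dil S]
  rfl

theorem memLp_quasiRegularFun (s : AffineGroup K) {φ : K → ℂ} (hφ : MemLp φ 2 μ) :
    MemLp (quasiRegularFun s φ) 2 μ := by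
  have hm : Measurable fun y : K => ((s.dil⁻¹ : Kˣ) : K) * (y - s.trans) :=
    ((continuous_const_mul _).comp (continuous_sub_right _)).measurable
  have h1 : MemLp φ 2 (μ.map fun y : K => ((s.dil⁻¹ : Kˣ) : K) * (y - s.trans)) := by
    rw [map_affine_eq_smul]
    exact hφ.smul_measure (by simp)
  exact (h1.comp_of_map hm.aemeasurable).const_mul _

/-- The quasi-regular representation `π` of `K ⋊ Kˣ` on `L²(K)`. -/
noncomputable def quasiRegular (s : AffineGroup K) (f : Lp ℂ 2 μ) : Lp ℂ 2 μ :=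
  (memLp_quasiRegularFun μ s (Lp.memLp f)).toLp (quasiRegularFun s f)

/-- The wavelet transform `W_g f (s) = ⟨f | π(s) g⟩` on `K ⋊ Kˣ`, where
`⟨f | g⟩ = ∫ f(x) conj(g(x)) dx` is linear in the first argument. -/
noncomputable def waveletTransform (g f : Lp ℂ 2 μ) (s : AffineGroup K) : ℂ :=
  inner ℂ (quasiRegular μ s g) f

end LocalField

/-- The space `S₀(K)`, as a set of elements of `L²(K)`: the (classes of) locally constant,
compactly supported functions with vanishing integral. -/
def schwartzZero {K : Type*} [TopologicalSpace K] [MeasurableSpace K] (μ : Measure K) :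
    Set (Lp ℂ 2 μ) :=
  {f | ∃ φ : K → ℂ, IsLocallyConstant φ ∧ HasCompactSupport φ ∧ ∫ x, φ x ∂μ = 0 ∧ f =ᵐ[μ] φ}

/-- The family `(v i)` is a tight frame of the Hilbert space `E` with frame constant `C`:
`C > 0` and `∑ i, |⟨f | v i⟩|² = C ‖f‖²` for all `f ∈ E`. -/
def IsTightFrame {ι E : Type*} [NormedAddCommGroup E] [InnerProductSpace ℂ E] (v : ι → E) (C : ℝ) :
    Prop :=
  0 < C ∧ ∀ f : E, HasSum (fun i => ‖inner ℂ (v i) f‖ ^ 2) (C * ‖f‖ ^ 2)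

/-! Everything rests on two features of `g ∈ S₀(K)`: its stabilizer in `G` is open
(`isOpen_quasiRegularStabilizer`), and its mean vanishes. Openness makes `W_g f` right invariant
under an open subgroup, hence continuous. For `f ∈ S₀(K)`, a very wide dilate of `g` is constant on
the support of `f`, so the mean zero of `f` kills the coefficient. Exchanging `f` and `g` handles
very narrow dilates, and for the remaining dilations the two supports must meet, which bounds the
translation (`hasCompactSupport_waveletTransform`). A compact set meets only finitely many cosets of
an open subgroup, so compact support makes the frame expansion finite. Conversely, a finite
expansion is a combination of vectors `π(r) g` and stays in `S₀(K)`.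

The converse needs at least one tight frame to exist, and this is the main work. Let `H` be compact
open and fix `g`. The coefficients along `G ⧸ H` map `S₀(K)` into `ℓ²`, and translating `f` only
permutes them, so they pull back an invariant inner product. A concrete form of Schur's lemma shows
that it is proportional to the `L²` one on the span of the orbit of one vector, the Haar wavelet `q
1_{pO} - 1_O`, with `O` the ring of integers, `p` a uniformizer and `q` the residue cardinality: an
invariant hermitian form is determined on this orbit by its value at the wavelet itself
(`eq_zero_of_hermitian_of_invariant`). The span is dense (`dense_span_quasiRegular_haarWavelet`),
and a limit argument extends the frame identity to `L²(K)` (`exists_hasSum_waveletTransform`). -/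

open ValuativeRel Topology

/-! ### Balls, locally constant functions and the residue field -/

section Valuation

/-- The family `ρ` represents the residue field: every integer is congruent to exactly one `ρ i`
modulo the maximal ideal. -/
structure IsResidueSystem {K ι : Type*} [Field K] [ValuativeRel K] (ρ : ι → K) : Prop where
  le_one : ∀ i, valuation K (ρ i) ≤ 1
  existsUnique : ∀ x, valuation K x ≤ 1 → ∃! i, valuation K (x - ρ i) < 1

theorem valuation_eq_of_sub_lt {K : Type*} [Field K] [ValuativeRel K] {x y : K} (h : valuation K (y - x) < valuation K x) :
    valuation K y = valuation K x := by
  have := (valuation K).map_add_eq_of_lt_right h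
  simpa using this

variable {K : Type*} [Field K] [ValuativeRel K] [TopologicalSpace K] [IsNonarchimedeanLocalField K]

/-- Basic neighbourhoods are given by strict inequalities; scaling the radius by an `r` with `0 <
v(r) < 1` replaces them by closed balls whose radius is an element of `Kˣ`. -/
theorem mem_nhds_zero_iff_exists_unit {s : Set K} :
    s ∈ 𝓝 (0 : K) ↔ ∃ b : Kˣ, ∀ x, valuation K x ≤ valuation K (b : K) → x ∈ s := by
  rw [IsValuativeTopology.mem_nhds_zero_iff]
  constructor
  · rintro ⟨γ, hγ⟩
    obtain ⟨c, hc⟩ := ValuativeRel.valuation_surjective (γ : ValueGroupWithZero K)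
    obtain ⟨r, hr, hr1⟩ := Valuation.IsNontrivial.exists_lt_one (v := valuation K)
    have hc0 : c ≠ 0 := by rintro rfl; simp at hc; exact γ.ne_zero hc.symm
    have hr0 : r ≠ 0 := by simpa using hr
    refine ⟨Units.mk0 (r * c) (mul_ne_zero hr0 hc0), fun x hx => hγ ?_⟩
    simp only [Units.val_mk0, map_mul] at hx
    refine hx.trans_lt ?_
    rw [← hc]
    have : 0 < valuation K c := by simpa [zero_lt_iff] using hc0
    calc _ < 1 * valuation K c := mul_lt_mul_of_pos_right hr1 this
      _ = _ := one_mul _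
  · rintro ⟨b, hb⟩
    refine ⟨Units.mk0 (valuation K (b : K)) (by simp), fun x hx => hb x ?_⟩
    exact le_of_lt hx

theorem isOpen_of_forall_valuation_sub {s : Set K} (b : Kˣ)
    (h : ∀ x ∈ s, ∀ y, valuation K (y - x) ≤ valuation K (b : K) → y ∈ s) : IsOpen s := by
  rw [isOpen_iff_mem_nhds]
  intro x hx
  have h0 : {t : K | valuation K t ≤ valuation K (b : K)} ∈ 𝓝 (0 : K) :=
    mem_nhds_zero_iff_exists_unit.2 ⟨b, fun _ => id⟩
  have hc : Filter.Tendsto (fun y : K => y - x) (𝓝 x) (𝓝 0) := by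
    have : Continuous fun y : K => y - x := by fun_prop
    simpa using this.tendsto x
  filter_upwards [hc h0] with y hy using h x hx y hy

theorem isOpen_valuation_le (b : Kˣ) : IsOpen {x : K | valuation K x ≤ valuation K (b : K)} :=
  isOpen_of_forall_valuation_sub b fun x hx y hy => by
    have := (valuation K).map_add (y - x) x
    simp only [sub_add_cancel] at this
    exact this.trans (max_le hy hx)

theorem isOpen_valuation_eq_one : IsOpen {x : K | valuation K x = 1} := by
  obtain ⟨r, hr, hr1⟩ := Valuation.IsNontrivial.exists_lt_one (v := valuation K)
  have hr0 : r ≠ 0 := by simpa using hr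
  refine isOpen_of_forall_valuation_sub (Units.mk0 r hr0) fun x hx y hy => ?_
  have hx' : valuation K x = 1 := hx
  exact (valuation_eq_of_sub_lt (hy.trans_lt (by rw [hx']; exact hr1))).trans hx'

instance : T2Space K := by
  refine IsTopologicalAddGroup.t2Space_of_zero_sep fun x hx => ?_
  obtain ⟨r, hr, hr1⟩ := Valuation.IsNontrivial.exists_lt_one (v := valuation K)
  have hr0 : r ≠ 0 := by simpa using hr
  refine ⟨_, mem_nhds_zero_iff_exists_unit.2 ⟨Units.mk0 (r * x) (mul_ne_zero hr0 hx), fun _ => id⟩,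
    fun h => ?_⟩
  simp only [Units.val_mk0, map_mul] at h
  have hx' : 0 < valuation K x := by simpa [zero_lt_iff] using hx
  have : valuation K r * valuation K x < 1 * valuation K x := mul_lt_mul_of_pos_right hr1 hx'
  rw [one_mul] at this
  exact absurd h this.not_ge

theorem exists_unit_valuation_bound {s : Set K} (hs : IsCompact s) :
    ∃ a : Kˣ, ∀ x ∈ s, valuation K x ≤ valuation K (a : K) := by
  obtain ⟨t, ht⟩ := hs.elim_directed_cover
    (fun a : Kˣ => {x : K | valuation K x ≤ valuation K (a : K)}) isOpen_valuation_le
    (fun x _ => by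
      by_cases hx : x = 0
      · exact Set.mem_iUnion.2 ⟨1, by simp [hx]⟩
      · exact Set.mem_iUnion.2 ⟨Units.mk0 x hx, by simp⟩)
    (fun a b => by
      rcases le_total (valuation K (a : K)) (valuation K (b : K)) with h | h
      · exact ⟨b, fun x (hx : valuation K x ≤ _) => hx.trans h, fun x hx => hx⟩
      · exact ⟨a, fun x hx => hx, fun x (hx : valuation K x ≤ _) => hx.trans h⟩)
  exact ⟨t, ht⟩

/-- A locally constant function of compact support is supported in a ball and invariant under
translation by a ball. -/
theorem exists_unit_bounds {φ : K → ℂ} (hφ : IsLocallyConstant φ) (hc : HasCompactSupport φ) :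
    (∃ a : Kˣ, ∀ x, φ x ≠ 0 → valuation K x ≤ valuation K (a : K)) ∧
    ∃ b : Kˣ, ∀ x y, valuation K (x - y) ≤ valuation K (b : K) → φ x = φ y := by
  refine ⟨?_, ?_⟩
  · obtain ⟨a, ha⟩ := exists_unit_valuation_bound hc
    exact ⟨a, fun x hx => ha x (subset_tsupport _ hx)⟩
  -- Compactness of the support turns local constancy at each point into one period valid at all
  -- points of the support.
  · have h1 : ∀ᶠ t in 𝓝 (0 : K), ∀ y ∈ tsupport φ, φ (y + t) = φ y := by
      refine IsCompact.eventually_forall_of_forall_eventually hc fun y _ => ?_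
      have h2 : IsLocallyConstant fun z : K × K => φ (z.2 + z.1) :=
        hφ.comp_continuous (f := fun z : K × K => z.2 + z.1) (by fun_prop)
      have h3 : IsLocallyConstant fun z : K × K => φ z.2 :=
        hφ.comp_continuous (f := fun z : K × K => z.2) (by fun_prop)
      filter_upwards [h2.eventually_eq (0, y), h3.eventually_eq (0, y)] with z hz hz'
      rw [hz, hz']; simp
    obtain ⟨b, hb⟩ := mem_nhds_zero_iff_exists_unit.1 h1
    refine ⟨b, fun x y hxy => ?_⟩
    -- The period is known only at base points of the support, so the translation starts from
    -- whichever of `x`, `y` lies in it.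
    by_cases hy : φ y = 0
    · by_cases hx : φ x = 0
      · rw [hx, hy]
      · have := hb (y - x) (by rwa [(valuation K).map_sub_swap]) x (subset_tsupport _ hx)
        simpa using this.symm
    · have := hb (x - y) hxy y (subset_tsupport _ hy)
      simpa using this

theorem isLocallyConstant_of_forall_valuation_sub {φ : K → ℂ} (b : Kˣ)
    (h : ∀ x y, valuation K (x - y) ≤ valuation K (b : K) → φ x = φ y) : IsLocallyConstant φ :=
  fun s => isOpen_of_forall_valuation_sub b fun x hx y hy => by
    rw [Set.mem_preimage, h y x hy]; exact hx

theorem hasCompactSupport_of_forall_valuation {φ : K → ℂ} (a : K)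
    (h : ∀ x, φ x ≠ 0 → valuation K x ≤ valuation K a) : HasCompactSupport φ :=
  HasCompactSupport.of_support_subset_isCompact
    (IsNonarchimedeanLocalField.isCompact_closedBall K (valuation K a)) fun x hx => h x hx

theorem exists_isResidueSystem :
    ∃ (ι : Type) (_ : Fintype ι) (ρ : ι → K), IsResidueSystem ρ := by
  obtain ⟨n, ⟨e⟩⟩ := Finite.exists_equiv_fin 𝓀[K]
  have hlt : ∀ x : 𝒪[K], IsLocalRing.residue 𝒪[K] x = 0 ↔ valuation K (x : K) < 1 := by
    intro x
    rw [IsLocalRing.residue_eq_zero_iff, IsLocalRing.mem_maximalIdeal, mem_nonunits_iff,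
      (Valuation.integer.integers (valuation K)).isUnit_iff_valuation_eq_one]
    exact (lt_iff_le_and_ne.trans (and_iff_right x.2)).symm
  let ρ : Fin n → 𝒪[K] := fun i => (IsLocalRing.residue_surjective (e.symm i)).choose
  have hρ : ∀ i, IsLocalRing.residue 𝒪[K] (ρ i) = e.symm i :=
    fun i => (IsLocalRing.residue_surjective (e.symm i)).choose_spec
  refine ⟨Fin n, inferInstance, fun i => (ρ i : K), fun i => (ρ i).2, fun x hx => ?_⟩
  have key : ∀ i, valuation K (x - ρ i) < 1 ↔ i = e (IsLocalRing.residue 𝒪[K] ⟨x, hx⟩) := by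
    intro i
    have := hlt (⟨x, hx⟩ - ρ i)
    rw [map_sub, hρ, sub_eq_zero] at this
    rw [← Equiv.symm_apply_eq, eq_comm, this]
    rfl
  exact ⟨_, (key _).2 rfl, fun i hi => (key i).1 hi⟩

/-- The valuation is discrete, so the maximal ideal is itself a closed ball, of radius `|p|`. -/
theorem exists_uniformizer :
    ∃ p : Kˣ, ∀ x : K, valuation K x < 1 ↔ valuation K x ≤ valuation K (p : K) := by
  obtain ⟨r, hr⟩ := ValuativeRel.valuation_surjective (uniformizer K)
  have hr0 : r ≠ 0 := by
    rintro rfl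
    simp only [map_zero] at hr
    exact uniformizer_ne_zero hr.symm
  refine ⟨Units.mk0 r hr0, fun x => ?_⟩
  simp only [Units.val_mk0, hr]
  exact ⟨fun h => le_uniformizer_iff.2 h, fun h => le_uniformizer_iff.1 h⟩

end Valuation

/-! ### Topology of the affine group -/

namespace AffineGroup

section Topology

variable {K : Type*} [Field K] [TopologicalSpace K]

theorem isInducing_prod : IsInducing (fun s : AffineGroup K => (s.trans, s.dil)) := ⟨rfl⟩

theorem continuous_trans : Continuous (AffineGroup.trans : AffineGroup K → K) :=
  continuous_fst.comp isInducing_prod.continuous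

theorem continuous_dil : Continuous (AffineGroup.dil : AffineGroup K → Kˣ) :=
  continuous_snd.comp isInducing_prod.continuous

theorem continuous_mk {X : Type*} [TopologicalSpace X] {a : X → K} {h : X → Kˣ}
    (ha : Continuous a) (hh : Continuous h) :
    Continuous (fun x => (⟨a x, h x⟩ : AffineGroup K)) :=
  isInducing_prod.continuous_iff.2 (ha.prodMk hh)

instance [IsTopologicalRing K] : ContinuousMul (AffineGroup K) := by
  refine ⟨continuous_mk (a := fun p : AffineGroup K × AffineGroup K =>
    (p.1.dil : K) * p.2.trans + p.1.trans) (h := fun p => p.1.dil * p.2.dil) ?_ ?_⟩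
  · exact ((Units.continuous_val.comp (continuous_dil.comp continuous_fst)).mul
      (continuous_trans.comp continuous_snd)).add (continuous_trans.comp continuous_fst)
  · exact (continuous_dil.comp continuous_fst).mul (continuous_dil.comp continuous_snd)

instance [T2Space K] : T2Space (AffineGroup K) :=
  T2Space.of_injective_continuous (f := fun s : AffineGroup K => (s.trans, s.dil))
    (fun _ _ h => AffineGroup.ext (congrArg Prod.fst h) (congrArg Prod.snd h))
    isInducing_prod.continuous

end Topology

section Valuation

variable {K : Type*} [Field K] [ValuativeRel K]

/-- The subgroup of affine maps preserving the ring of integers. -/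
def integral (K : Type*) [Field K] [ValuativeRel K] : Subgroup (AffineGroup K) where
  carrier := {s | valuation K s.trans ≤ 1 ∧ valuation K (s.dil : K) = 1}
  one_mem' := by simp [trans_one, dil_one]
  mul_mem' := by
    rintro s t ⟨h1, h2⟩ ⟨h3, h4⟩
    refine ⟨?_, by simp [dil_mul, h2, h4]⟩
    rw [trans_mul]
    exact ((valuation K).map_add _ _).trans (max_le (by simpa [h2] using h3) h1)
  inv_mem' := by
    rintro s ⟨h1, h2⟩
    exact ⟨by simpa [trans_inv, h2] using h1, by simp [dil_inv, h2]⟩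

theorem mem_integral {s : AffineGroup K} :
    s ∈ integral K ↔ valuation K s.trans ≤ 1 ∧ valuation K (s.dil : K) = 1 := Iff.rfl

variable [TopologicalSpace K] [IsNonarchimedeanLocalField K]

theorem isCompact_box (c d : K) :
    IsCompact {s : AffineGroup K | valuation K s.trans ≤ valuation K c ∧
      valuation K (s.dil : K) ≤ valuation K d ∧ valuation K (s.dil⁻¹ : Kˣ) ≤ valuation K d} := by
  have hb := fun a : K => IsNonarchimedeanLocalField.isCompact_closedBall K (valuation K a)
  -- The topology of `Kˣ` comes from `u ↦ (u, u⁻¹)`, a closed embedding, so both `u` and `u⁻¹` must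
  -- be bounded.
  have h1 : IsCompact ((Units.embedProduct K) ⁻¹'
      ({x : K | valuation K x ≤ valuation K d} ×ˢ
        (MulOpposite.unop ⁻¹' {x : K | valuation K x ≤ valuation K d}))) := by
    refine Units.isClosedEmbedding_embedProduct.isCompact_preimage ?_
    refine (hb d).prod ?_
    have := MulOpposite.opHomeomorph.isCompact_image.2 (hb d)
    rwa [Homeomorph.image_eq_preimage_symm] at this
  have h2 := ((hb c).prod h1).image (f := fun p : K × Kˣ => (⟨p.1, p.2⟩ : AffineGroup K))
    (continuous_mk continuous_fst continuous_snd)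
  convert! h2 using 1
  ext s
  constructor
  · rintro ⟨hs1, hs2, hs3⟩
    exact ⟨(s.trans, s.dil), ⟨hs1, hs2, hs3⟩, rfl⟩
  · rintro ⟨p, ⟨hp1, hp2, hp3⟩, rfl⟩
    exact ⟨hp1, hp2, hp3⟩

theorem isCompact_integral : IsCompact (integral K : Set (AffineGroup K)) := by
  convert! isCompact_box (1 : K) (1 : K) using 1
  ext s
  simp only [SetLike.mem_coe, mem_integral, Set.mem_ofPred_eq, map_one, Units.val_inv_eq_inv_val,
    map_inv₀]
  refine and_congr_right fun _ => ⟨fun h => by simp [h], fun h => le_antisymm h.1 ?_⟩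
  have h0 : 0 < valuation K (s.dil : K) := by simp [zero_lt_iff]
  exact (inv_le_one₀ h0).1 h.2

theorem isOpen_integral : IsOpen (integral K : Set (AffineGroup K)) := by
  have h1 := (isOpen_valuation_le (1 : Kˣ)).preimage (continuous_trans (K := K))
  have h2 := (isOpen_valuation_eq_one (K := K)).preimage
    (Units.continuous_val.comp (continuous_dil (K := K)))
  convert h1.inter h2 using 1
  ext s
  simp [mem_integral]

/-- The affine maps close to the identity, measured by `a` and `b`, form a neighbourhood of it. -/
theorem mem_nhds_one (a b : Kˣ) :
    {s : AffineGroup K | valuation K s.trans ≤ valuation K (b : K) ∧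
      valuation K (s.dil : K) = 1 ∧
      valuation K ((s.dil : K) - 1) * valuation K (a : K) ≤ valuation K (b : K)} ∈
      𝓝 (1 : AffineGroup K) := by
  have hv := Units.continuous_val.comp (continuous_dil (K := K))
  have h1 := (isOpen_valuation_le b).preimage (continuous_trans (K := K))
  have h2 := (isOpen_valuation_eq_one (K := K)).preimage hv
  have h3 := (isOpen_valuation_le b).preimage ((hv.sub continuous_const).mul continuous_const :
    Continuous fun s : AffineGroup K => ((s.dil : K) - 1) * (a : K))
  refine Filter.mem_of_superset ((h1.inter (h2.inter h3)).mem_nhds ?_) ?_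
  · simp [trans_one, dil_one]
  · rintro s ⟨h1, h2, h3⟩
    exact ⟨h1, h2, by simpa using h3⟩

end Valuation

end AffineGroup

/-! ### The quasi-regular representation is unitary -/

section Representation

variable {K : Type*} [Field K] [ValuativeRel K] [TopologicalSpace K] [IsNonarchimedeanLocalField K]

theorem haarAbs_pos (h : Kˣ) : 0 < haarAbs h := distribHaarChar_pos

theorem haarAbs_mul (h k : Kˣ) : haarAbs (h * k) = haarAbs h * haarAbs k := map_mul _ _ _

theorem haarAbs_one : haarAbs (1 : Kˣ) = 1 := map_one _

open scoped Pointwise in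
-- A unit maps the ring of integers onto itself, and that set has positive finite measure.
theorem haarAbs_eq_one {h : Kˣ} (hh : valuation K (h : K) = 1) : haarAbs h = 1 := by
  borelize K
  let μ : Measure K := Measure.addHaar
  refine distribHaarChar_eq_of_measure_smul_eq_mul (μ := μ) (s := {x : K | valuation K x ≤ 1})
    ?_ ?_ ?_
  · have ho : IsOpen {x : K | valuation K x ≤ 1} := by simpa using isOpen_valuation_le (1 : Kˣ)
    exact (ho.measure_pos μ ⟨0, by simp⟩).ne'
  · exact (IsNonarchimedeanLocalField.isCompact_closedBall K 1).measure_lt_top.ne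
  · have : h • {x : K | valuation K x ≤ 1} = {x : K | valuation K x ≤ 1} := by
      ext x
      rw [Set.mem_smul_set_iff_inv_smul_mem]
      simp [Units.smul_def, hh]
    rw [this, ENNReal.coe_one, one_mul]

theorem quasiRegularFun_mul (s t : AffineGroup K) (φ : K → ℂ) :
    quasiRegularFun (s * t) φ = quasiRegularFun s (quasiRegularFun t φ) := by
  funext y
  simp only [quasiRegularFun, AffineGroup.dil_mul, AffineGroup.trans_mul, haarAbs_mul]
  rw [← mul_assoc, ← Complex.ofReal_mul, NNReal.coe_mul,
    Real.mul_rpow (by positivity) (by positivity)]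
  congr 2
  have hs := s.dil.ne_zero
  have ht := t.dil.ne_zero
  simp only [Units.val_inv_eq_inv_val, Units.val_mul]
  field_simp
  ring

variable [MeasurableSpace K] [BorelSpace K] (μ : Measure K) [μ.IsAddHaarMeasure] [μ.Regular]

theorem measurable_affine (s : AffineGroup K) :
    Measurable fun y : K => ((s.dil⁻¹ : Kˣ) : K) * (y - s.trans) :=
  ((continuous_const_mul _).comp (continuous_sub_right _)).measurable

theorem quasiMeasurePreserving_affine (s : AffineGroup K) :
    Measure.QuasiMeasurePreserving (fun y : K => ((s.dil⁻¹ : Kˣ) : K) * (y - s.trans)) μ μ :=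
  ⟨measurable_affine s, by
    rw [map_affine_eq_smul]
    exact Measure.smul_absolutelyContinuous⟩

theorem quasiRegularFun_ae_congr (s : AffineGroup K) {φ ψ : K → ℂ} (h : φ =ᵐ[μ] ψ) :
    quasiRegularFun s φ =ᵐ[μ] quasiRegularFun s ψ := by
  filter_upwards [(quasiMeasurePreserving_affine μ s).ae_eq h] with y hy
  simp only [quasiRegularFun]
  congr 1

theorem coeFn_quasiRegular (s : AffineGroup K) (f : Lp ℂ 2 μ) :
    quasiRegular μ s f =ᵐ[μ] quasiRegularFun s f := MemLp.coeFn_toLp _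

theorem coeFn_quasiRegular_of_ae (s : AffineGroup K) {f : Lp ℂ 2 μ} {φ : K → ℂ} (h : f =ᵐ[μ] φ) :
    quasiRegular μ s f =ᵐ[μ] quasiRegularFun s φ :=
  (coeFn_quasiRegular μ s f).trans (quasiRegularFun_ae_congr μ s h)

/-- Each `π(s)` as a linear map. -/
noncomputable def quasiRegularLinear (s : AffineGroup K) : Lp ℂ 2 μ →ₗ[ℂ] Lp ℂ 2 μ where
  toFun := quasiRegular μ s
  map_add' f g := by
    refine Lp.ext ?_
    filter_upwards [coeFn_quasiRegular_of_ae μ s (Lp.coeFn_add f g), coeFn_quasiRegular μ s f,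
      coeFn_quasiRegular μ s g, Lp.coeFn_add (quasiRegular μ s f) (quasiRegular μ s g)]
      with y h1 h2 h3 h4
    rw [h1, h4, Pi.add_apply, h2, h3]
    simp [quasiRegularFun, mul_add]
  map_smul' c f := by
    refine Lp.ext ?_
    filter_upwards [coeFn_quasiRegular_of_ae μ s (Lp.coeFn_smul c f), coeFn_quasiRegular μ s f,
      Lp.coeFn_smul c (quasiRegular μ s f)] with y h1 h2 h3
    rw [h1, RingHom.id_apply, h3, Pi.smul_apply, h2]
    simp [quasiRegularFun, mul_left_comm]

theorem quasiRegular_smul (s : AffineGroup K) (c : ℂ) (f : Lp ℂ 2 μ) :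
    quasiRegular μ s (c • f) = c • quasiRegular μ s f :=
  (quasiRegularLinear μ s).map_smul c f

theorem quasiRegular_sum {ι : Type*} (s : AffineGroup K) (t : Finset ι) (f : ι → Lp ℂ 2 μ) :
    quasiRegular μ s (∑ i ∈ t, f i) = ∑ i ∈ t, quasiRegular μ s (f i) :=
  map_sum (quasiRegularLinear μ s) f t

theorem quasiRegular_mul (s t : AffineGroup K) (f : Lp ℂ 2 μ) :
    quasiRegular μ (s * t) f = quasiRegular μ s (quasiRegular μ t f) := by
  refine Lp.ext ((coeFn_quasiRegular μ _ f).trans ?_)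
  rw [quasiRegularFun_mul]
  exact (coeFn_quasiRegular_of_ae μ s (coeFn_quasiRegular μ t f)).symm

theorem quasiRegular_one (f : Lp ℂ 2 μ) : quasiRegular μ 1 f = f := by
  refine Lp.ext ((coeFn_quasiRegular μ _ f).trans (.of_forall fun y => ?_))
  simp [quasiRegularFun, AffineGroup.dil_one, AffineGroup.trans_one, haarAbs_one]

/-- The two factors `|h|^{-1/2}` multiply to `|h|⁻¹`, which cancels the Jacobian of the change of
variables. -/
theorem inner_quasiRegular (s : AffineGroup K) (f g : Lp ℂ 2 μ) :
    inner ℂ (quasiRegular μ s f) (quasiRegular μ s g) = inner ℂ f g := by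
  have hpos : (0 : ℝ) < haarAbs s.dil := haarAbs_pos _
  rw [L2.inner_def, L2.inner_def]
  have h1 : ∫ y, inner ℂ (quasiRegular μ s f y) (quasiRegular μ s g y) ∂μ =
      ∫ y, ((haarAbs s.dil : ℝ)⁻¹ : ℝ) •
        (fun z => inner ℂ (f z) (g z)) (((s.dil⁻¹ : Kˣ) : K) * (y - s.trans)) ∂μ := by
    refine integral_congr_ae ?_
    filter_upwards [coeFn_quasiRegular μ s f, coeFn_quasiRegular μ s g] with y h2 h3
    rw [h2, h3]
    have h4 : ((haarAbs s.dil : ℝ) ^ (-(1 / 2) : ℝ)) * ((haarAbs s.dil : ℝ) ^ (-(1 / 2) : ℝ)) =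
        (haarAbs s.dil : ℝ)⁻¹ := by
      rw [← Real.rpow_add hpos, ← Real.rpow_neg_one]; norm_num
    simp only [quasiRegularFun, RCLike.inner_apply, map_mul, Complex.conj_ofReal, ← h4,
      Complex.real_smul, Complex.ofReal_mul]
    ring
  have h5 := integral_map (μ := μ) (f := fun z => (inner ℂ (f z) (g z) : ℂ)) (measurable_affine s).aemeasurable (by
    rw [map_affine_eq_smul]
    exact ((Lp.aestronglyMeasurable f).inner (Lp.aestronglyMeasurable g)).smul_measure _)
  rw [h1, integral_smul, ← h5, map_affine_eq_smul, integral_smul_nnreal_measure, NNReal.smul_def, smul_smul,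
    inv_mul_cancel₀ hpos.ne', one_smul]

theorem inner_quasiRegular_left (s : AffineGroup K) (f g : Lp ℂ 2 μ) :
    inner ℂ (quasiRegular μ s f) g = inner ℂ f (quasiRegular μ s⁻¹ g) := by
  rw [← inner_quasiRegular μ s⁻¹, ← quasiRegular_mul, inv_mul_cancel, quasiRegular_one]

theorem norm_quasiRegular (s : AffineGroup K) (f : Lp ℂ 2 μ) : ‖quasiRegular μ s f‖ = ‖f‖ := by
  rw [@norm_eq_sqrt_re_inner ℂ, @norm_eq_sqrt_re_inner ℂ _ _ _ _ f, inner_quasiRegular]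

end Representation

/-! ### The space `S₀(K)` and compact support of wavelet transforms -/

section SchwartzZero

variable {K : Type*} [Field K] [ValuativeRel K] [TopologicalSpace K] [IsNonarchimedeanLocalField K]

theorem exists_unit_valuation_bound_pair (x y : K) :
    ∃ a : Kˣ, valuation K x ≤ valuation K (a : K) ∧ valuation K y ≤ valuation K (a : K) := by
  obtain ⟨a, ha⟩ := exists_unit_valuation_bound (Set.toFinite {x, y}).isCompact
  exact ⟨a, ha x (by simp), ha y (by simp)⟩

theorem isLocallyConstant_quasiRegularFun (s : AffineGroup K) {φ : K → ℂ}
    (hφ : IsLocallyConstant φ) : IsLocallyConstant (quasiRegularFun s φ) :=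
  (hφ.comp_continuous (f := fun y : K => ((s.dil⁻¹ : Kˣ) : K) * (y - s.trans))
    (by fun_prop)).comp fun z => (((haarAbs s.dil : ℝ) ^ (-(1 / 2) : ℝ) : ℝ) : ℂ) * z

theorem valuation_le_of_quasiRegularFun_ne_zero (s : AffineGroup K) {φ : K → ℂ} {a : K}
    (ha : ∀ x, φ x ≠ 0 → valuation K x ≤ valuation K a) {y : K} (hy : quasiRegularFun s φ y ≠ 0) :
    valuation K (y - s.trans) ≤ valuation K (s.dil * a) := by
  have h1 := ha _ (right_ne_zero_of_mul hy)
  have h2 : y - s.trans = s.dil * (((s.dil⁻¹ : Kˣ) : K) * (y - s.trans)) := by simp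
  rw [h2, map_mul, map_mul _ _ a]
  exact mul_le_mul_right h1 _

theorem hasCompactSupport_quasiRegularFun (s : AffineGroup K) {φ : K → ℂ}
    (hφ : IsLocallyConstant φ) (hc : HasCompactSupport φ) :
    HasCompactSupport (quasiRegularFun s φ) := by
  obtain ⟨a, ha⟩ := (exists_unit_bounds hφ hc).1
  obtain ⟨c, h1, h2⟩ := exists_unit_valuation_bound_pair (s.dil * a : K) s.trans
  refine hasCompactSupport_of_forall_valuation (c : K) fun y hy => ?_
  have h3 := (valuation_le_of_quasiRegularFun_ne_zero s ha hy).trans h1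
  simpa using ((valuation K).map_add (y - s.trans) s.trans).trans (max_le h3 h2)

variable [MeasurableSpace K] [BorelSpace K] (μ : Measure K) [μ.IsAddHaarMeasure] [μ.Regular]

theorem integral_quasiRegularFun (s : AffineGroup K) {φ : K → ℂ} (hφ : Continuous φ) :
    ∫ y, quasiRegularFun s φ y ∂μ =
      (((haarAbs s.dil : ℝ) ^ (-(1 / 2) : ℝ) : ℝ) : ℂ) * (haarAbs s.dil • ∫ y, φ y ∂μ) := by
  have h5 := integral_map (μ := μ) (f := φ) (measurable_affine s).aemeasurable
    hφ.aestronglyMeasurable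
  simp only [quasiRegularFun]
  rw [integral_const_mul, ← h5, map_affine_eq_smul, integral_smul_nnreal_measure]

/-- The space `S₀(K)` as a subspace of `L²(K)`. -/
def schwartzZeroSubmodule : Submodule ℂ (Lp ℂ 2 μ) where
  carrier := schwartzZero μ
  zero_mem' := ⟨0, IsLocallyConstant.const 0, HasCompactSupport.zero, by simp, Lp.coeFn_zero _ _ _⟩
  add_mem' := by
    rintro f g ⟨φ, h1, h2, h3, h4⟩ ⟨ψ, k1, k2, k3, k4⟩
    refine ⟨φ + ψ, h1.add k1, h2.add k2, ?_, ?_⟩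
    · simp only [Pi.add_apply]
      rw [integral_add (h1.continuous.integrable_of_hasCompactSupport h2)
        (k1.continuous.integrable_of_hasCompactSupport k2), h3, k3, add_zero]
    · exact (Lp.coeFn_add f g).trans (h4.add k4)
  smul_mem' := by
    rintro c f ⟨φ, h1, h2, h3, h4⟩
    refine ⟨fun x => c * φ x, h1.comp fun z => c * z, h2.mul_left, ?_, ?_⟩
    · rw [integral_const_mul, h3, mul_zero]
    · filter_upwards [Lp.coeFn_smul c f, h4] with x hx hx'
      rw [hx, Pi.smul_apply, hx', smul_eq_mul]

variable {μ}

theorem quasiRegular_mem_schwartzZero (s : AffineGroup K) {f : Lp ℂ 2 μ}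
    (hf : f ∈ schwartzZero μ) : quasiRegular μ s f ∈ schwartzZero μ := by
  obtain ⟨φ, h1, h2, h3, h4⟩ := hf
  refine ⟨quasiRegularFun s φ, isLocallyConstant_quasiRegularFun s h1,
    hasCompactSupport_quasiRegularFun s h1 h2, ?_, coeFn_quasiRegular_of_ae μ s h4⟩
  rw [integral_quasiRegularFun μ s h1.continuous, h3, smul_zero, mul_zero]

/-- The subgroup fixing a vector of the quasi-regular representation. -/
def quasiRegularStabilizer (g : Lp ℂ 2 μ) : Subgroup (AffineGroup K) where
  carrier := {s | quasiRegular μ s g = g}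
  one_mem' := quasiRegular_one μ g
  mul_mem' := by
    intro s t hs ht
    rw [Set.mem_ofPred_eq, quasiRegular_mul, ht, hs]
  inv_mem' := by
    intro s hs
    have hs' : quasiRegular μ s g = g := hs
    rw [Set.mem_ofPred_eq]
    nth_rw 1 [← hs']
    rw [← quasiRegular_mul, inv_mul_cancel, quasiRegular_one]

theorem mem_quasiRegularStabilizer {g : Lp ℂ 2 μ} {s : AffineGroup K} :
    s ∈ quasiRegularStabilizer g ↔ quasiRegular μ s g = g := Iff.rfl

/-- An affine map close to the identity moves points of the support of `φ` by less than a period of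
`φ`. -/
theorem isOpen_quasiRegularStabilizer {g : Lp ℂ 2 μ} (hg : g ∈ schwartzZero μ) :
    IsOpen (quasiRegularStabilizer g : Set (AffineGroup K)) := by
  obtain ⟨φ, h1, h2, -, h4⟩ := hg
  obtain ⟨⟨a, ha⟩, ⟨b, hb⟩⟩ := exists_unit_bounds h1 h2
  refine Subgroup.isOpen_of_mem_nhds _ (g := 1)
    (Filter.mem_of_superset (AffineGroup.mem_nhds_one a b) ?_)
  rintro s ⟨hs1, hs2, hs3⟩
  rw [SetLike.mem_coe, mem_quasiRegularStabilizer]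
  refine Lp.ext ((coeFn_quasiRegular_of_ae μ s h4).trans (Filter.EventuallyEq.trans ?_ h4.symm))
  refine .of_forall fun y => ?_
  simp only [quasiRegularFun, haarAbs_eq_one hs2, NNReal.coe_one, Real.one_rpow,
    Complex.ofReal_one, one_mul]
  set z := ((s.dil⁻¹ : Kˣ) : K) * (y - s.trans) with hz
  have hyz : y = s.dil * z + s.trans := by simp [hz]
  have key : ∀ w : K, valuation K w ≤ valuation K (a : K) →
      valuation K (((s.dil : K) - 1) * w + s.trans) ≤ valuation K (b : K) := fun w hw =>
    ((valuation K).map_add _ _).trans (max_le (by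
      rw [map_mul]; exact (mul_le_mul_right hw _).trans hs3) hs1)
  -- As the dilation is a unit, the displacement has the same size computed at `y` or at `z`;
  -- whichever lies in the support gives the bound.
  have h5 : valuation K (y - z) = valuation K (((s.dil : K) - 1) * y + s.trans) := by
    have : (s.dil : K) * (y - z) = ((s.dil : K) - 1) * y + s.trans := by
      rw [mul_sub, sub_mul, one_mul]; nth_rw 3 [hyz]; ring
    rw [← this, map_mul, hs2, one_mul]
  by_cases hy : φ y = 0
  · by_cases hzz : φ z = 0
    · rw [hy, hzz]
    · refine (hb y z ?_).symm
      have := key z (ha z hzz)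
      rwa [show ((s.dil : K) - 1) * z + s.trans = y - z by rw [hyz]; ring] at this
  · exact (hb y z (h5.trans_le (key y (ha y hy)))).symm

theorem waveletTransform_mul_of_mem {g : Lp ℂ 2 μ} (f : Lp ℂ 2 μ) (s : AffineGroup K)
    {k : AffineGroup K} (hk : k ∈ quasiRegularStabilizer g) :
    waveletTransform μ g f (s * k) = waveletTransform μ g f s := by
  rw [waveletTransform, quasiRegular_mul, mem_quasiRegularStabilizer.1 hk, waveletTransform]

theorem continuous_waveletTransform {g : Lp ℂ 2 μ} (hg : g ∈ schwartzZero μ) (f : Lp ℂ 2 μ) :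
    Continuous (waveletTransform μ g f) := by
  refine IsLocallyConstant.continuous ((IsLocallyConstant.iff_eventually_eq _).2 fun s => ?_)
  have h1 : IsOpen ((fun t => s⁻¹ * t) ⁻¹' (quasiRegularStabilizer g : Set (AffineGroup K))) :=
    (isOpen_quasiRegularStabilizer hg).preimage (continuous_const_mul _)
  filter_upwards [h1.mem_nhds (by simp)] with t ht
  have := waveletTransform_mul_of_mem f s (SetLike.mem_coe.1 ht)
  simpa using this

theorem waveletTransform_eq_integral {f g : Lp ℂ 2 μ} {φ ψ : K → ℂ} (hf : f =ᵐ[μ] φ)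
    (hg : g =ᵐ[μ] ψ) (s : AffineGroup K) :
    waveletTransform μ g f s = ∫ y, φ y * starRingEnd ℂ (quasiRegularFun s ψ y) ∂μ := by
  rw [waveletTransform, L2.inner_def]
  refine integral_congr_ae ?_
  filter_upwards [hf, coeFn_quasiRegular_of_ae μ s hg] with y h1 h2
  rw [h1, h2, RCLike.inner_apply]

/-- Exchanging the roles of `f` and `g` inverts the group element, so a bound on large dilations
also yields one on small dilations. -/
theorem waveletTransform_inv (f g : Lp ℂ 2 μ) (s : AffineGroup K) :
    waveletTransform μ g f s = starRingEnd ℂ (waveletTransform μ f g s⁻¹) := by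
  rw [waveletTransform, waveletTransform, inner_quasiRegular_left, inner_conj_symm]

/-- The dilate of `ψ` is so wide that it is constant on the support of `φ`, which has mean zero. -/
theorem waveletTransform_eq_zero_of_le {f g : Lp ℂ 2 μ} {φ ψ : K → ℂ} (hf : f =ᵐ[μ] φ)
    (hg : g =ᵐ[μ] ψ) (hφ : ∫ y, φ y ∂μ = 0) {a b : K}
    (ha : ∀ x, φ x ≠ 0 → valuation K x ≤ valuation K a)
    (hb : ∀ x y, valuation K (x - y) ≤ valuation K b → ψ x = ψ y) {s : AffineGroup K}
    (hs : valuation K ((s.dil⁻¹ : Kˣ) * a) ≤ valuation K b) :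
    waveletTransform μ g f s = 0 := by
  have h1 : ∀ y, φ y * starRingEnd ℂ (quasiRegularFun s ψ y) =
      φ y * starRingEnd ℂ (quasiRegularFun s ψ 0) := by
    intro y
    by_cases hy : φ y = 0
    · simp [hy]
    · congr 2
      simp only [quasiRegularFun]
      congr 1
      refine hb _ _ (le_trans ?_ hs)
      rw [← mul_sub, map_mul, map_mul _ _ a]
      simpa using mul_le_mul_right (ha y hy) _
  rw [waveletTransform_eq_integral hf hg]
  simp only [h1]
  rw [integral_mul_const, hφ, zero_mul]

theorem hasCompactSupport_waveletTransform {f g : Lp ℂ 2 μ} (hf : f ∈ schwartzZero μ)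
    (hg : g ∈ schwartzZero μ) : HasCompactSupport (waveletTransform μ g f) := by
  obtain ⟨φ, h1, h2, h3, h4⟩ := hf
  obtain ⟨ψ, k1, k2, k3, k4⟩ := hg
  obtain ⟨⟨a, ha⟩, ⟨b, hb⟩⟩ := exists_unit_bounds h1 h2
  obtain ⟨⟨a', ha'⟩, ⟨b', hb'⟩⟩ := exists_unit_bounds k1 k2
  -- Beyond `a / b'` the dilate of `ψ` is constant on the support of `φ`; `a' / b` plays this role
  -- with `φ` and `ψ` exchanged. The bound `c` covers `trans = y - (y - trans)` for a point `y`
  -- common to both supports.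
  obtain ⟨d, hd, hd'⟩ := exists_unit_valuation_bound_pair (a / b' : K) (a' / b)
  obtain ⟨c, hc, hc'⟩ := exists_unit_valuation_bound_pair (a : K) (d * a')
  refine HasCompactSupport.of_support_subset_isCompact
    (AffineGroup.isCompact_box (c : K) (d : K)) fun s hs => ?_
  have hpos : ∀ u : Kˣ, 0 < valuation K (u : K) := fun u => by simp [zero_lt_iff]
  have e1 : valuation K (s.dil : K) ≤ valuation K (d : K) := by
    by_contra! h
    refine hs (waveletTransform_eq_zero_of_le h4 k4 h3 ha hb' ?_)
    have h' := (hd.trans_lt h).le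
    rw [map_div₀, div_le_iff₀ (hpos _)] at h'
    rw [map_mul, Units.val_inv_eq_inv_val, map_inv₀, inv_mul_le_iff₀ (hpos _)]
    exact h'
  have e2 : valuation K (s.dil⁻¹ : Kˣ) ≤ valuation K (d : K) := by
    by_contra! h
    refine hs ?_
    rw [waveletTransform_inv, waveletTransform_eq_zero_of_le k4 h4 k3 ha' hb, map_zero]
    have h' := (hd'.trans_lt h).le
    rw [map_div₀, div_le_iff₀ (hpos _)] at h'
    rw [AffineGroup.dil_inv, map_mul, Units.val_inv_eq_inv_val, map_inv₀,
      inv_mul_le_iff₀ (hpos _)]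
    exact h'
  refine ⟨?_, e1, e2⟩
  obtain ⟨y, hy⟩ : ∃ y, φ y * starRingEnd ℂ (quasiRegularFun s ψ y) ≠ 0 := by
    by_contra! h
    exact hs (by rw [waveletTransform_eq_integral h4 k4]; simp [h])
  have m1 := (ha y (left_ne_zero_of_mul hy)).trans hc
  have m2 := valuation_le_of_quasiRegularFun_ne_zero s ha'
    ((map_ne_zero _).1 (right_ne_zero_of_mul hy))
  have m3 : valuation K (s.dil * a' : K) ≤ valuation K (c : K) := by
    refine le_trans ?_ hc'
    rw [map_mul, map_mul]
    exact mul_le_mul_left e1 _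
  have := (valuation K).map_sub y (y - s.trans)
  rw [sub_sub_cancel] at this
  exact this.trans (max_le m1 (m2.trans m3))

end SchwartzZero

/-! ### Balls form a π-system and determine functions -/

section Ball

variable {K : Type*} [Field K] [ValuativeRel K]

/-- The image of the ring of integers under an affine map. -/
def AffineGroup.ball (s : AffineGroup K) : Set K :=
  {y | valuation K (y - s.trans) ≤ valuation K (s.dil : K)}

theorem AffineGroup.mem_ball_iff {s : AffineGroup K} {y : K} :
    y ∈ s.ball ↔ valuation K (((s.dil⁻¹ : Kˣ) : K) * (y - s.trans)) ≤ 1 := by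
  rw [map_mul, Units.val_inv_eq_inv_val, map_inv₀, inv_mul_le_iff₀ (by simp [zero_lt_iff]), mul_one]
  rfl

theorem AffineGroup.mem_ball_of_mem_of_le {s t : AffineGroup K} {x y : K} (hx : x ∈ s.ball)
    (hx' : x ∈ t.ball) (hy : y ∈ s.ball) (h : valuation K (s.dil : K) ≤ valuation K (t.dil : K)) :
    y ∈ t.ball := by
  have h1 : valuation K (y - x) ≤ valuation K (t.dil : K) := by
    have := (valuation K).map_sub (y - s.trans) (x - s.trans)
    rw [sub_sub_sub_cancel_right] at this
    exact (this.trans (max_le hy hx)).trans h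
  have := (valuation K).map_add (y - x) (x - t.trans)
  rw [sub_add_sub_cancel] at this
  exact this.trans (max_le h1 hx')

/-- By the ultrametric inequality, of two balls that meet the one of smaller radius lies in the
other. -/
theorem AffineGroup.ball_inter_ball (s t : AffineGroup K) :
    s.ball ∩ t.ball = ∅ ∨ s.ball ∩ t.ball = s.ball ∨ s.ball ∩ t.ball = t.ball := by
  rcases (s.ball ∩ t.ball).eq_empty_or_nonempty with h | ⟨x, hx, hx'⟩
  · exact .inl h
  · rcases le_total (valuation K (s.dil : K)) (valuation K (t.dil : K)) with h | h
    · exact .inr (.inl (Set.inter_eq_left.2 fun y hy => mem_ball_of_mem_of_le hx hx' hy h))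
    · exact .inr (.inr (Set.inter_eq_right.2 fun y hy => mem_ball_of_mem_of_le hx' hx hy h))

end Ball

section Density

variable {K : Type*} [Field K] [ValuativeRel K] [TopologicalSpace K] [IsNonarchimedeanLocalField K]

/-- Needed so that the balls, being a basis, generate the Borel σ-algebra; it holds because `K` is a
proper metric space for a compatible norm. -/
instance : SecondCountableTopology K := by
  let := IsTopologicalAddGroup.rightUniformSpace K
  have := isUniformAddGroup_of_addCommGroup (G := K)
  let : (Valued.v (R := K)).RankOne :=
  { hom' := IsRankLeOne.nonempty.some.emb (R := K).comp MonoidWithZeroHom.ValueGroup₀.embedding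
    strictMono' := IsRankLeOne.nonempty.some.strictMono.comp
        MonoidWithZeroHom.ValueGroup₀.embedding_strictMono }
  open scoped Valued in
  have : ProperSpace K := .of_nontriviallyNormedField_of_weaklyLocallyCompactSpace K
  exact secondCountable_of_proper

theorem AffineGroup.isOpen_ball (s : AffineGroup K) : IsOpen s.ball :=
  (isOpen_valuation_le s.dil).preimage (continuous_sub_right s.trans)

theorem AffineGroup.isTopologicalBasis_range_ball :
    TopologicalSpace.IsTopologicalBasis (Set.range (AffineGroup.ball (K := K))) := by
  refine TopologicalSpace.isTopologicalBasis_of_isOpen_of_nhds ?_ fun x u hx hu => ?_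
  · rintro _ ⟨s, rfl⟩
    exact s.isOpen_ball
  · have h1 : {t : K | x + t ∈ u} ∈ 𝓝 (0 : K) :=
      (hu.preimage (continuous_const_add x)).mem_nhds (by simpa using hx)
    obtain ⟨b, hb⟩ := mem_nhds_zero_iff_exists_unit.1 h1
    refine ⟨_, ⟨⟨x, b⟩, rfl⟩, ?_, fun y hy => ?_⟩
    · simp [ball]
    · have h2 : x + (y - x) ∈ u := hb (y - x) hy
      simpa using h2

variable [MeasurableSpace K] [BorelSpace K] {μ : Measure K}

/-- Dynkin induction: the balls together with `∅` form a generating π-system. Intersecting with a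
fixed ball `B` that contains the compact set keeps `f` integrable, which complements and countable
unions require. -/
theorem ae_eq_zero_of_forall_setIntegral_ball [IsLocallyFiniteMeasure μ] {f : K → ℂ}
    (hf : LocallyIntegrable f μ) (h : ∀ s : AffineGroup K, ∫ y in s.ball, f y ∂μ = 0) :
    f =ᵐ[μ] 0 := by
  refine ae_eq_zero_of_forall_setIntegral_isCompact_eq_zero' hf fun S hS => ?_
  obtain ⟨a, ha⟩ := exists_unit_valuation_bound hS
  set B : AffineGroup K := ⟨0, a⟩
  have hSB : S ⊆ B.ball := fun x hx => by simpa [AffineGroup.ball, B] using ha x hx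
  have hB : IntegrableOn f B.ball μ := by
    refine hf.integrableOn_isCompact ?_
    have := IsNonarchimedeanLocalField.isCompact_closedBall K (valuation K (a : K))
    simpa [AffineGroup.ball, B] using this
  have key : ∀ (T : Set K) (hT : MeasurableSet T), ∫ y in T ∩ B.ball, f y ∂μ = 0 := by
    refine MeasurableSpace.induction_on_inter (s := Set.range AffineGroup.ball ∪ {∅})
      (C := fun T _ => ∫ y in T ∩ B.ball, f y ∂μ = 0) ?_ ?_ ?_ ?_ ?_ ?_
    · have := (AffineGroup.isTopologicalBasis_range_ball (K := K)).borel_eq_generateFrom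
      rw [BorelSpace.measurable_eq (α := K), this, Set.union_comm, Set.singleton_union,
        MeasurableSpace.generateFrom_insert_empty]
    · rintro _ (⟨s, rfl⟩ | rfl) _ (⟨t, rfl⟩ | rfl) hne
      · rcases s.ball_inter_ball t with h1 | h1 | h1 <;> rw [h1]
        · exact .inr rfl
        · exact .inl ⟨s, rfl⟩
        · exact .inl ⟨t, rfl⟩
      all_goals simp
    · simp
    · rintro _ (⟨s, rfl⟩ | rfl)
      · rcases s.ball_inter_ball B with h1 | h1 | h1 <;> rw [h1]
        · simp
        · exact h s
        · exact h B
      · simp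
    · intro T hT hT0
      have h1 : Tᶜ ∩ B.ball = B.ball \ (T ∩ B.ball) := by
        ext x; simp only [Set.mem_inter_iff, Set.mem_compl_iff, Set.mem_sdiff]; tauto
      rw [h1, setIntegral_sdiff (hT.inter B.isOpen_ball.measurableSet) hB Set.inter_subset_right,
        h B, hT0, sub_zero]
    · intro T hd hT hT0
      rw [Set.iUnion_inter]
      have h1 := hasSum_integral_iUnion (f := f) (μ := μ) (s := fun i => T i ∩ B.ball)
        (fun i => (hT i).inter B.isOpen_ball.measurableSet)
        (fun i j hij => (hd hij).mono Set.inter_subset_left Set.inter_subset_left)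
        (hB.mono_set (Set.iUnion_subset fun i => Set.inter_subset_right))
      simp only [hT0] at h1
      exact h1.unique hasSum_zero
  have := key S hS.measurableSet
  rwa [Set.inter_eq_left.2 hSB] at this

end Density

/-! ### The indicator of the integers -/

section Indicator

variable {K : Type*} [Field K] [ValuativeRel K]

variable (K) in
/-- The indicator function of the ring of integers. -/
noncomputable def integersIndicator : K → ℂ := Set.indicator {x : K | valuation K x ≤ 1} 1

theorem integersIndicator_of_le {x : K} (hx : valuation K x ≤ 1) : integersIndicator K x = 1 :=
  Set.indicator_of_mem (s := {x : K | valuation K x ≤ 1}) hx _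

theorem integersIndicator_of_not_le {x : K} (hx : ¬ valuation K x ≤ 1) :
    integersIndicator K x = 0 :=
  Set.indicator_of_notMem (s := {x : K | valuation K x ≤ 1}) hx _

end Indicator

/-! ### The Haar wavelet and its orbit -/

section Wavelet

variable {K : Type*} [Field K] [ValuativeRel K]

theorem IsResidueSystem.one_lt_card {ι : Type*} [Fintype ι] {ρ : ι → K}
    (hρ : IsResidueSystem ρ) : 1 < Fintype.card ι := by
  obtain ⟨i, hi, -⟩ := hρ.existsUnique 0 (by simp)
  obtain ⟨j, hj, -⟩ := hρ.existsUnique 1 (by simp)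
  refine Fintype.one_lt_card_iff.2 ⟨i, j, ?_⟩
  rintro rfl
  have := (valuation K).map_sub (1 - ρ i) (0 - ρ i)
  simp only [sub_zero, sub_sub_sub_cancel_right, map_one] at this
  exact absurd (max_lt hj hi) this.not_gt

/-- The function equal to `q - 1` on the ball of the uniformizer `p` and to `-1` on the rest of the
ring of integers. -/
noncomputable def haarWaveletFun (p : Kˣ) (q : ℕ) (x : K) : ℂ :=
  q * integersIndicator K (((p⁻¹ : Kˣ) : K) * x) - integersIndicator K x

/-- The residue classes `ρ i + pO` partition `O`: on `O` exactly one summand contributes `q`, and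
the `q` copies of `-1` cancel it. -/
theorem sum_haarWaveletFun {p : Kˣ} (hp : ∀ x : K, valuation K x < 1 ↔ valuation K x ≤ valuation K p)
    {ι : Type*} [Fintype ι] {ρ : ι → K} (hρ : IsResidueSystem ρ) (x : K) :
    ∑ i, haarWaveletFun p (Fintype.card ι) (x - ρ i) = 0 := by
  have h0 : ∀ y : K, valuation K (((p⁻¹ : Kˣ) : K) * y) ≤ 1 ↔ valuation K y < 1 := by
    intro y
    rw [map_mul, Units.val_inv_eq_inv_val, map_inv₀, inv_mul_le_iff₀ (by simp [zero_lt_iff]),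
      mul_one, hp]
  have key : ∀ i, valuation K (x - ρ i) ≤ 1 ↔ valuation K x ≤ 1 := by
    intro i
    constructor <;> intro h
    · have := (valuation K).map_add (x - ρ i) (ρ i)
      rw [sub_add_cancel] at this
      exact this.trans (max_le h (hρ.le_one i))
    · exact ((valuation K).map_sub _ _).trans (max_le h (hρ.le_one i))
  by_cases hx : valuation K x ≤ 1
  · obtain ⟨i, hi, hi'⟩ := hρ.existsUnique x hx
    have h1 : ∀ j, j ≠ i → integersIndicator K (((p⁻¹ : Kˣ) : K) * (x - ρ j)) = 0 := fun j hj =>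
      integersIndicator_of_not_le fun h => hj (hi' j ((h0 _).1 h))
    simp only [haarWaveletFun]
    rw [Finset.sum_sub_distrib, ← Finset.mul_sum,
      Finset.sum_eq_single i (fun j _ hj => h1 j hj) (by simp),
      integersIndicator_of_le ((h0 _).2 hi)]
    simp [integersIndicator_of_le, key, hx]
  · refine Finset.sum_eq_zero fun i _ => ?_
    rw [haarWaveletFun, integersIndicator_of_not_le, integersIndicator_of_not_le]
    · simp
    · rwa [key]
    · rw [h0]; exact fun h => hx ((key i).1 h.le)

variable [TopologicalSpace K] [IsNonarchimedeanLocalField K]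

theorem isLocallyConstant_integersIndicator : IsLocallyConstant (integersIndicator K) := by
  refine isLocallyConstant_of_forall_valuation_sub 1 fun x y hxy => ?_
  simp only [Units.val_one, map_one] at hxy
  have key : ∀ x y : K, valuation K (x - y) ≤ 1 → valuation K y ≤ 1 → valuation K x ≤ 1 := by
    intro x y h1 h2
    have := (valuation K).map_add (x - y) y
    rw [sub_add_cancel] at this
    exact this.trans (max_le h1 h2)
  by_cases hy : valuation K y ≤ 1
  · rw [integersIndicator_of_le hy, integersIndicator_of_le (key x y hxy hy)]
  · rw [integersIndicator_of_not_le hy, integersIndicator_of_not_le fun hx => hy (key y x ?_ hx)]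
    rwa [(valuation K).map_sub_swap]

theorem hasCompactSupport_integersIndicator : HasCompactSupport (integersIndicator K) :=
  hasCompactSupport_of_forall_valuation 1 fun x hx => by
    by_contra h
    exact hx (integersIndicator_of_not_le (by simpa using h))

theorem quasiRegularFun_integersIndicator (s : AffineGroup K) :
    quasiRegularFun s (integersIndicator K) =
      s.ball.indicator fun _ => (((haarAbs s.dil : ℝ) ^ (-(1 / 2) : ℝ) : ℝ) : ℂ) := by
  funext y
  by_cases hy : y ∈ s.ball
  · rw [Set.indicator_of_mem hy, quasiRegularFun,
      integersIndicator_of_le (AffineGroup.mem_ball_iff.1 hy), mul_one]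
  · rw [Set.indicator_of_notMem hy, quasiRegularFun,
      integersIndicator_of_not_le (mt AffineGroup.mem_ball_iff.2 hy), mul_zero]

theorem isLocallyConstant_haarWaveletFun (p : Kˣ) (q : ℕ) :
    IsLocallyConstant (haarWaveletFun p q) :=
  ((isLocallyConstant_integersIndicator.comp_continuous
    (f := fun x : K => ((p⁻¹ : Kˣ) : K) * x) (by fun_prop)).comp fun z => (q : ℂ) * z).sub
    isLocallyConstant_integersIndicator

theorem hasCompactSupport_haarWaveletFun (p : Kˣ) (q : ℕ) :
    HasCompactSupport (haarWaveletFun p q) := by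
  obtain ⟨a, h1, h2⟩ := exists_unit_valuation_bound_pair (p : K) 1
  refine hasCompactSupport_of_forall_valuation (a : K) fun x hx => ?_
  by_contra h
  refine hx ?_
  rw [haarWaveletFun, integersIndicator_of_not_le, integersIndicator_of_not_le]
  · simp
  · exact fun h3 => h (h3.trans (by simpa using h2))
  · intro h3
    refine h (le_trans ?_ h1)
    rwa [map_mul, Units.val_inv_eq_inv_val, map_inv₀, inv_mul_le_iff₀ (by simp [zero_lt_iff]),
      mul_one] at h3

variable [MeasurableSpace K] [BorelSpace K] (μ : Measure K) [μ.IsAddHaarMeasure]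

/-- The `q` translates have equal integrals and add up to zero. -/
theorem integral_haarWaveletFun {p : Kˣ}
    (hp : ∀ x : K, valuation K x < 1 ↔ valuation K x ≤ valuation K p)
    {ι : Type*} [Fintype ι] {ρ : ι → K} (hρ : IsResidueSystem ρ) :
    ∫ x, haarWaveletFun p (Fintype.card ι) x ∂μ = 0 := by
  have h0 : Continuous (haarWaveletFun p (Fintype.card ι)) :=
    (isLocallyConstant_haarWaveletFun p _).continuous
  have h1 : Integrable (haarWaveletFun p (Fintype.card ι)) μ :=
    h0.integrable_of_hasCompactSupport (hasCompactSupport_haarWaveletFun p _)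
  have h2 : ∫ x, ∑ i, haarWaveletFun p (Fintype.card ι) (x - ρ i) ∂μ = 0 := by
    simp [sum_haarWaveletFun hp hρ]
  rw [integral_finsetSum _ fun i _ => h1.comp_sub_right (ρ i)] at h2
  simp only [integral_sub_right_eq_self, Finset.sum_const, Finset.card_univ, nsmul_eq_mul,
    mul_eq_zero, Nat.cast_eq_zero] at h2
  exact h2.resolve_left (by have := hρ.one_lt_card; omega)

/-- Mean zero of the wavelet reads `q |p| μ(O) = μ(O)`. -/
theorem card_mul_haarAbs_uniformizer {p : Kˣ}
    (hp : ∀ x : K, valuation K x < 1 ↔ valuation K x ≤ valuation K p)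
    {ι : Type*} [Fintype ι] {ρ : ι → K} (hρ : IsResidueSystem ρ) :
    (Fintype.card ι : ℝ) * haarAbs p = 1 := by
  borelize K
  let μ : Measure K := Measure.addHaar
  have h0 := (isLocallyConstant_integersIndicator (K := K)).continuous
  have hi : Integrable (integersIndicator K) μ :=
    h0.integrable_of_hasCompactSupport hasCompactSupport_integersIndicator
  have hw : Integrable (haarWaveletFun p (Fintype.card ι)) μ :=
    (isLocallyConstant_haarWaveletFun p _).continuous.integrable_of_hasCompactSupport
      (hasCompactSupport_haarWaveletFun p _)
  have ho : IsOpen {x : K | valuation K x ≤ 1} := by simpa using isOpen_valuation_le (1 : Kˣ)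
  have hm : μ.real {x : K | valuation K x ≤ 1} ≠ 0 :=
    (ENNReal.toReal_pos (ho.measure_pos μ ⟨0, by simp⟩).ne'
      (IsNonarchimedeanLocalField.isCompact_closedBall K 1).measure_lt_top.ne).ne'
  have h1 : ∫ x, integersIndicator K x ∂μ = (μ.real {x : K | valuation K x ≤ 1} : ℂ) :=
    (integral_indicator_const (1 : ℂ) ho.measurableSet).trans (by simp)
  have h2 := integral_map (μ := μ) (measurable_affine (⟨0, p⟩ : AffineGroup K)).aemeasurable
    h0.aestronglyMeasurable
  rw [map_affine_eq_smul, integral_smul_nnreal_measure, h1] at h2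
  have h3 : ∫ x, (Fintype.card ι : ℂ) * integersIndicator K (((p⁻¹ : Kˣ) : K) * x) ∂μ =
      ∫ x, (haarWaveletFun p (Fintype.card ι) x + integersIndicator K x) ∂μ := by
    simp [haarWaveletFun]
  simp only [sub_zero] at h2
  rw [integral_add hw hi, integral_haarWaveletFun μ hp hρ, zero_add, integral_const_mul, ← h2, h1,
    NNReal.smul_def, Complex.real_smul] at h3
  have h4 : (Fintype.card ι : ℝ) * (haarAbs p * μ.real {x : K | valuation K x ≤ 1}) =
      μ.real {x : K | valuation K x ≤ 1} := by exact_mod_cast h3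
  rw [← mul_assoc] at h4
  exact mul_right_cancel₀ hm (h4.trans (one_mul _).symm)

/-- The indicator function of the ring of integers as an element of `L²(K)`. -/
noncomputable def integersLp : Lp ℂ 2 μ :=
  (isLocallyConstant_integersIndicator.continuous.memLp_of_hasCompactSupport
    hasCompactSupport_integersIndicator : MemLp (integersIndicator K) 2 μ).toLp _

theorem coeFn_integersLp : integersLp μ =ᵐ[μ] integersIndicator K := MemLp.coeFn_toLp _

variable [μ.Regular]

variable {μ} in
theorem inner_quasiRegular_integersLp (s : AffineGroup K) (f : Lp ℂ 2 μ) :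
    inner ℂ (quasiRegular μ s (integersLp μ)) f =
      (((haarAbs s.dil : ℝ) ^ (-(1 / 2) : ℝ) : ℝ) : ℂ) * ∫ y in s.ball, f y ∂μ := by
  rw [L2.inner_def, ← integral_const_mul, ← integral_indicator s.isOpen_ball.measurableSet]
  refine integral_congr_ae ?_
  filter_upwards [coeFn_quasiRegular_of_ae μ s (coeFn_integersLp μ)] with y hy
  rw [hy, quasiRegularFun_integersIndicator]
  by_cases h : y ∈ s.ball
  · simp [h, mul_comm]
  · simp [h]

variable {μ} in
theorem eq_zero_of_forall_inner_quasiRegular_integersLp {f : Lp ℂ 2 μ}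
    (h : ∀ s : AffineGroup K, inner ℂ (quasiRegular μ s (integersLp μ)) f = 0) : f = 0 := by
  refine (Lp.eq_zero_iff_ae_eq_zero).2 ?_
  refine ae_eq_zero_of_forall_setIntegral_ball
    ((Lp.memLp f).locallyIntegrable (by norm_num)) fun s => ?_
  have h1 := h s
  rw [inner_quasiRegular_integersLp] at h1
  refine (mul_eq_zero.1 h1).resolve_left ?_
  have : (0 : ℝ) < haarAbs s.dil := haarAbs_pos _
  exact Complex.ofReal_ne_zero.2 (by positivity)

theorem quasiRegular_integersLp {s : AffineGroup K} (hs : s ∈ AffineGroup.integral K) :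
    quasiRegular μ s (integersLp μ) = integersLp μ := by
  refine Lp.ext ((coeFn_quasiRegular_of_ae μ s (coeFn_integersLp μ)).trans
    (Filter.EventuallyEq.trans (.of_forall fun y => ?_) (coeFn_integersLp μ).symm))
  have h1 : valuation K (((s.dil⁻¹ : Kˣ) : K) * (y - s.trans)) = valuation K (y - s.trans) := by
    simp [hs.2]
  rw [quasiRegularFun, haarAbs_eq_one hs.2]
  simp only [NNReal.coe_one, Real.one_rpow, Complex.ofReal_one, one_mul]
  by_cases hy : valuation K y ≤ 1
  · rw [integersIndicator_of_le hy, integersIndicator_of_le]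
    rw [h1]
    exact ((valuation K).map_sub _ _).trans (max_le hy hs.1)
  · rw [integersIndicator_of_not_le hy, integersIndicator_of_not_le]
    rw [h1]
    intro h2
    have := (valuation K).map_add (y - s.trans) s.trans
    rw [sub_add_cancel] at this
    exact hy (this.trans (max_le h2 hs.1))

/-- The class of `haarWaveletFun` in `L²(K)`. -/
noncomputable def haarWavelet (p : Kˣ) (q : ℕ) : Lp ℂ 2 μ :=
  ((q * (haarAbs p : ℝ) ^ (1 / 2 : ℝ) : ℝ) : ℂ) • quasiRegular μ ⟨0, p⟩ (integersLp μ) -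
    integersLp μ

theorem coeFn_haarWavelet (p : Kˣ) (q : ℕ) : haarWavelet μ p q =ᵐ[μ] haarWaveletFun p q := by
  have hpos : (0 : ℝ) < haarAbs p := haarAbs_pos _
  filter_upwards [Lp.coeFn_sub (((q * (haarAbs p : ℝ) ^ (1 / 2 : ℝ) : ℝ) : ℂ) •
      quasiRegular μ ⟨0, p⟩ (integersLp μ)) (integersLp μ),
    Lp.coeFn_smul ((q * (haarAbs p : ℝ) ^ (1 / 2 : ℝ) : ℝ) : ℂ)
      (quasiRegular μ ⟨0, p⟩ (integersLp μ)), coeFn_integersLp μ,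
    coeFn_quasiRegular_of_ae μ ⟨0, p⟩ (coeFn_integersLp μ)] with y h1 h2 h3 h4
  rw [haarWavelet, h1, Pi.sub_apply, h2, Pi.smul_apply, h3, h4, haarWaveletFun, quasiRegularFun,
    smul_eq_mul, ← mul_assoc, ← Complex.ofReal_mul, mul_assoc (q : ℝ), ← Real.rpow_add hpos]
  norm_num

theorem quasiRegular_haarWavelet (p : Kˣ)
    (hp : ∀ x : K, valuation K x < 1 ↔ valuation K x ≤ valuation K p) (q : ℕ) {s : AffineGroup K}
    (h1 : valuation K s.trans < 1) (h2 : valuation K (s.dil : K) = 1) :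
    quasiRegular μ s (haarWavelet μ p q) = haarWavelet μ p q := by
  have h3 : quasiRegular μ s (quasiRegular μ ⟨0, p⟩ (integersLp μ)) =
      quasiRegular μ ⟨0, p⟩ (integersLp μ) := by
    -- Moving `s` past the dilation divides its translation part by `p`; the result is integral
    -- exactly because that part lies in the maximal ideal.
    have h4 : s * ⟨0, p⟩ = (⟨0, p⟩ : AffineGroup K) * ⟨((p⁻¹ : Kˣ) : K) * s.trans, s.dil⟩ := by
      ext
      · simp [AffineGroup.trans_mul]
      · simp [AffineGroup.dil_mul, mul_comm]
    rw [← quasiRegular_mul, h4, quasiRegular_mul, quasiRegular_integersLp]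
    refine ⟨?_, h2⟩
    rw [map_mul, Units.val_inv_eq_inv_val, map_inv₀, inv_mul_le_iff₀ (by simp [zero_lt_iff]),
      mul_one, ← hp]
    exact h1
  have h5 := (quasiRegularLinear μ s).map_sub
    (((q * (haarAbs p : ℝ) ^ (1 / 2 : ℝ) : ℝ) : ℂ) • quasiRegular μ ⟨0, p⟩ (integersLp μ))
    (integersLp μ)
  change quasiRegular μ s _ = quasiRegular μ s _ - quasiRegular μ s _ at h5
  rw [haarWavelet, h5, quasiRegular_smul, h3, quasiRegular_integersLp μ ⟨h1.le, h2⟩]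

theorem sum_quasiRegular_haarWavelet {p : Kˣ}
    (hp : ∀ x : K, valuation K x < 1 ↔ valuation K x ≤ valuation K p)
    {ι : Type*} [Fintype ι] {ρ : ι → K} (hρ : IsResidueSystem ρ) :
    ∑ i, quasiRegular μ ⟨ρ i, 1⟩ (haarWavelet μ p (Fintype.card ι)) = 0 := by
  refine Lp.ext ?_
  have h1 : ∀ i, quasiRegular μ ⟨ρ i, 1⟩ (haarWavelet μ p (Fintype.card ι)) =ᵐ[μ]
      fun x => haarWaveletFun p (Fintype.card ι) (x - ρ i) := fun i =>
    (coeFn_quasiRegular_of_ae μ _ (coeFn_haarWavelet μ p _)).trans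
      (.of_forall fun y => by simp [quasiRegularFun, haarAbs_one])
  have h2 : ∀ᵐ x ∂μ, ∀ i, quasiRegular μ ⟨ρ i, 1⟩ (haarWavelet μ p (Fintype.card ι)) x =
      haarWaveletFun p (Fintype.card ι) (x - ρ i) := ae_all_iff.2 h1
  filter_upwards [h2, Lp.coeFn_zero ℂ 2 μ, Lp.coeFn_finsetSum Finset.univ
    fun i => quasiRegular μ ⟨ρ i, 1⟩ (haarWavelet μ p (Fintype.card ι))] with x h3 h4 h5
  rw [h4, h5, Finset.sum_apply, Pi.zero_apply, ← sum_haarWaveletFun hp hρ x]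
  exact Finset.sum_congr rfl fun i _ => h3 i

theorem haarWavelet_mem_schwartzZero {p : Kˣ}
    (hp : ∀ x : K, valuation K x < 1 ↔ valuation K x ≤ valuation K p)
    {ι : Type*} [Fintype ι] {ρ : ι → K} (hρ : IsResidueSystem ρ) :
    haarWavelet μ p (Fintype.card ι) ∈ schwartzZero μ :=
  ⟨_, isLocallyConstant_haarWaveletFun p _, hasCompactSupport_haarWaveletFun p _,
    integral_haarWaveletFun μ hp hρ, coeFn_haarWavelet μ p _⟩

variable {μ} in
-- Orthogonality to the orbit means that passing to the ball larger by one power of `p` multiplies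
-- the coefficient of its normalized indicator by `r = q |p|^{1/2} = √q > 1`. These coefficients are
-- bounded by Cauchy-Schwarz, so they all vanish, and `f` has integral zero over every ball.
theorem eq_zero_of_forall_inner_quasiRegular_haarWavelet {p : Kˣ}
    (hp : ∀ x : K, valuation K x < 1 ↔ valuation K x ≤ valuation K p)
    {ι : Type*} [Fintype ι] {ρ : ι → K} (hρ : IsResidueSystem ρ) {f : Lp ℂ 2 μ}
    (h : ∀ s : AffineGroup K,
      inner ℂ (quasiRegular μ s (haarWavelet μ p (Fintype.card ι))) f = 0) : f = 0 := by
  have hpos : (0 : ℝ) < haarAbs p := haarAbs_pos _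
  set r : ℝ := Fintype.card ι * (haarAbs p : ℝ) ^ (1 / 2 : ℝ) with hr
  have hr0 : 0 ≤ r := by positivity
  have hr1 : 1 < r := by
    have h1 : r ^ 2 = Fintype.card ι := by
      rw [hr, mul_pow, ← Real.rpow_natCast, ← Real.rpow_natCast, ← Real.rpow_mul hpos.le]
      norm_num
      rw [pow_two, mul_assoc, card_mul_haarAbs_uniformizer hp hρ, mul_one]
    have h2 : (1 : ℝ) < Fintype.card ι := by exact_mod_cast hρ.one_lt_card
    nlinarith
  refine eq_zero_of_forall_inner_quasiRegular_integersLp fun s => ?_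
  have step : ∀ s : AffineGroup K, inner ℂ (quasiRegular μ s (integersLp μ)) f =
      r * inner ℂ (quasiRegular μ (s * ⟨0, p⟩) (integersLp μ)) f := by
    intro s
    have h1 := h s
    have h2 := (quasiRegularLinear μ s).map_sub
      ((r : ℂ) • quasiRegular μ ⟨0, p⟩ (integersLp μ)) (integersLp μ)
    change quasiRegular μ s _ = quasiRegular μ s _ - quasiRegular μ s _ at h2
    rw [haarWavelet, ← hr, h2, quasiRegular_smul, ← quasiRegular_mul, inner_sub_left,
      inner_smul_left, Complex.conj_ofReal, sub_eq_zero] at h1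
    exact h1.symm
  have bound : ∀ n : ℕ, ∀ s : AffineGroup K,
      r ^ n * ‖(inner ℂ (quasiRegular μ s (integersLp μ)) f : ℂ)‖ ≤ ‖integersLp μ‖ * ‖f‖ := by
    intro n
    induction n with
    | zero =>
      intro s
      rw [pow_zero, one_mul]
      exact (norm_inner_le_norm _ _).trans_eq (by rw [norm_quasiRegular])
    | succ n ih =>
      intro s
      have h1 := ih (s * ⟨0, p⟩⁻¹)
      rw [step, inv_mul_cancel_right, norm_mul, Complex.norm_real, Real.norm_of_nonneg hr0,
        ← mul_assoc, ← pow_succ] at h1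
      exact h1
  by_contra hne
  have hpos' : 0 < ‖(inner ℂ (quasiRegular μ s (integersLp μ)) f : ℂ)‖ := norm_pos_iff.2 hne
  obtain ⟨n, hn⟩ := pow_unbounded_of_one_lt
    (‖integersLp μ‖ * ‖f‖ / ‖(inner ℂ (quasiRegular μ s (integersLp μ)) f : ℂ)‖) hr1
  rw [div_lt_iff₀ hpos'] at hn
  exact absurd (bound n s) hn.not_ge

end Wavelet

/-! ### Uniqueness of the invariant inner product -/

section Schur

variable {K : Type*} [Field K] [ValuativeRel K]

open AffineGroup in
/-- A hermitian function on the affine group that is invariant under the stabilizer of the Haar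
wavelet, has vanishing residue sums and vanishes at the identity is zero. -/
theorem eq_zero_of_hermitian_of_invariant {ι : Type*} [Fintype ι] {ρ : ι → K}
    (hρ : IsResidueSystem ρ) {β : AffineGroup K → ℂ}
    (hleft : ∀ s t : AffineGroup K, valuation K s.trans < 1 → valuation K (s.dil : K) = 1 →
      β (s * t) = β t)
    (hinv : ∀ t, β t⁻¹ = starRingEnd ℂ (β t)) (hsum : ∀ t, ∑ i, β (t * ⟨ρ i, 1⟩) = 0)
    (hone : β 1 = 0) (t : AffineGroup K) : β t = 0 := by
  have hcard : (Fintype.card ι : ℂ) ≠ 0 := by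
    have := hρ.one_lt_card
    exact_mod_cast (by omega : Fintype.card ι ≠ 0)
  -- Hermitian symmetry turns left invariance into right invariance.
  have hright : ∀ s t : AffineGroup K, valuation K s.trans < 1 → valuation K (s.dil : K) = 1 →
      β (t * s) = β t := by
    intro s t h1 h2
    have h3 := hleft s⁻¹ t⁻¹ (by simpa [trans_inv, h2] using h1) (by simp [dil_inv, h2])
    rw [← mul_inv_rev, hinv, hinv] at h3
    exact star_injective h3
  -- A contraction carries the residue translations into the maximal ideal, where left invariance
  -- absorbs them: all terms of the vanishing sum equal `β t`.
  have hsmall : ∀ t : AffineGroup K, valuation K (t.dil : K) < 1 → β t = 0 := by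
    intro t ht
    have h1 : ∀ i, β (t * ⟨ρ i, 1⟩) = β t := by
      intro i
      have h2 : t * ⟨ρ i, 1⟩ = (⟨t.dil * ρ i, 1⟩ : AffineGroup K) * t := by
        ext <;> simp [trans_mul, dil_mul]; ring
      rw [h2]
      refine hleft _ _ ?_ (by simp)
      rw [map_mul]
      exact (mul_le_mul_right (hρ.le_one i) _).trans_lt (by simpa using ht)
    have h3 := hsum t
    simp only [h1, Finset.sum_const, Finset.card_univ, nsmul_eq_mul] at h3
    exact (mul_eq_zero.1 h3).resolve_left hcard
  -- Conjugation by unit dilations makes `β` on pure translations depend only on `|x|`.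
  have hunit : ∀ (x : K) (u : Kˣ), valuation K (u : K) = 1 → β ⟨u * x, 1⟩ = β ⟨x, 1⟩ := by
    intro x u hu
    have h1 : (⟨u * x, 1⟩ : AffineGroup K) = ⟨0, u⟩ * ⟨x, 1⟩ * ⟨0, u⁻¹⟩ := by
      ext <;> simp [trans_mul, dil_mul]
    rw [h1, hright _ _ (by simp) (by simp [hu]), hleft _ _ (by simp) hu]
  have hsumx : ∀ x : K, ∑ i, β ⟨x + ρ i, 1⟩ = 0 := by
    intro x
    rw [← hsum ⟨x, 1⟩]
    refine Finset.sum_congr rfl fun i _ => ?_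
    congr 1
    ext <;> simp [trans_mul, dil_mul, add_comm]
  have hlt : ∀ x : K, valuation K x < 1 → β ⟨x, 1⟩ = 0 := by
    intro x hx
    rw [← hone, ← hleft ⟨x, 1⟩ 1 hx (by simp), mul_one]
  have heq : ∀ x y : K, valuation K x = valuation K y → x ≠ 0 → y ≠ 0 →
      β ⟨x, 1⟩ = β ⟨y, 1⟩ := by
    intro x y hxy hx hy
    have h1 := hunit y (Units.mk0 (x / y) (div_ne_zero hx hy))
      (by rw [Units.val_mk0, map_div₀, hxy, div_self]; simpa using hy)
    rw [← h1, Units.val_mk0, div_mul_cancel₀ x hy]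
  have htrans : ∀ x : K, β ⟨x, 1⟩ = 0 := by
    intro x
    rcases lt_trichotomy (valuation K x) 1 with hx | hx | hx
    · exact hlt x hx
    · have hx0 : x ≠ 0 := by rintro rfl; simp at hx
      obtain ⟨i, hi, hi'⟩ := hρ.existsUnique 0 (by simp)
      classical
      -- One residue is zero and contributes `0`; the other `q - 1` have absolute value one and
      -- contribute the same value.
      have h1 : ∀ j, β ⟨0 + ρ j, 1⟩ = if j = i then 0 else β ⟨x, 1⟩ := by
        intro j
        rw [zero_add]
        split_ifs with hj
        · subst hj
          exact hlt _ (by simpa using hi)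
        · have h2 : valuation K (ρ j) = 1 := by
            refine le_antisymm (hρ.le_one j) (not_lt.1 fun h3 => hj (hi' j ?_))
            simpa using h3
          exact heq _ _ (h2.trans hx.symm) (by intro h0; simp [h0] at h2) hx0
      have h3 := hsumx 0
      simp only [h1] at h3
      rw [Finset.sum_ite, Finset.sum_const_zero, zero_add, Finset.sum_const, nsmul_eq_mul] at h3
      refine (mul_eq_zero.1 h3).resolve_left ?_
      rw [Finset.filter_ne', Finset.card_erase_of_mem (Finset.mem_univ i), Finset.card_univ]
      have := hρ.one_lt_card
      exact_mod_cast (by omega : Fintype.card ι - 1 ≠ 0)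
    · have hx0 : x ≠ 0 := by rintro rfl; simp at hx
      have h1 : ∀ i, β ⟨x + ρ i, 1⟩ = β ⟨x, 1⟩ := by
        intro i
        have h2 : valuation K (x + ρ i) = valuation K x :=
          valuation_eq_of_sub_lt (by simpa using (hρ.le_one i).trans_lt hx)
        refine heq _ _ h2 (fun h0 => ?_) hx0
        rw [h0, map_zero] at h2
        exact hx0 ((map_eq_zero _).1 h2.symm)
      have h3 := hsumx x
      simp only [h1, Finset.sum_const, Finset.card_univ, nsmul_eq_mul] at h3
      exact (mul_eq_zero.1 h3).resolve_left hcard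
  rcases lt_trichotomy (valuation K (t.dil : K)) 1 with ht | ht | ht
  · exact hsmall t ht
  · have h1 : t = (⟨t.trans, 1⟩ : AffineGroup K) * ⟨0, t.dil⟩ := by
      ext <;> simp [trans_mul, dil_mul]
    rw [h1, hright ⟨0, t.dil⟩ _ (by simp) ht]
    exact htrans _
  -- An expanding map is the inverse of a contracting one.
  · have h1 : β t⁻¹ = 0 := by
      refine hsmall _ ?_
      rw [dil_inv, Units.val_inv_eq_inv_val, map_inv₀]
      exact inv_lt_one_of_one_lt₀ ht
    rw [hinv] at h1
    exact (map_eq_zero _).1 h1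

variable [TopologicalSpace K] [IsNonarchimedeanLocalField K]
variable [MeasurableSpace K] [BorelSpace K] {μ : Measure K} [μ.IsAddHaarMeasure] [μ.Regular]

/-- The restriction of `π(s)` to `S₀(K)`. -/
noncomputable def quasiRegularSchwartz (s : AffineGroup K) (f : schwartzZeroSubmodule μ) :
    schwartzZeroSubmodule μ :=
  ⟨quasiRegular μ s f, quasiRegular_mem_schwartzZero s f.2⟩

/-- Invariant inner products on `S₀(K)` are proportional on the orbit of the Haar wavelet. -/
theorem inner_map_quasiRegular_haarWavelet {E : Type*} [NormedAddCommGroup E]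
    [InnerProductSpace ℂ E] {L : schwartzZeroSubmodule μ →ₗ[ℂ] E}
    (hL : ∀ s f f', inner ℂ (L (quasiRegularSchwartz s f)) (L (quasiRegularSchwartz s f')) =
      inner ℂ (L f) (L f')) {p : Kˣ}
    (hp : ∀ x : K, valuation K x < 1 ↔ valuation K x ≤ valuation K p)
    {ι : Type*} [Fintype ι] {ρ : ι → K} (hρ : IsResidueSystem ρ) (v : schwartzZeroSubmodule μ)
    (hv : (v : Lp ℂ 2 μ) = haarWavelet μ p (Fintype.card ι)) (s t : AffineGroup K) :
    (‖(v : Lp ℂ 2 μ)‖ ^ 2 : ℂ) * inner ℂ (L (quasiRegularSchwartz s v)) (L (quasiRegularSchwartz t v)) =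
      ‖L v‖ ^ 2 * inner ℂ (quasiRegular μ s v) (quasiRegular μ t v) := by
  have hmul : ∀ (s t : AffineGroup K) (f : schwartzZeroSubmodule μ),
      quasiRegularSchwartz (s * t) f = quasiRegularSchwartz s (quasiRegularSchwartz t f) :=
    fun s t f => Subtype.ext (quasiRegular_mul μ s t f)
  have hone : ∀ f : schwartzZeroSubmodule μ, quasiRegularSchwartz 1 f = f :=
    fun f => Subtype.ext (quasiRegular_one μ f)
  have hfix : ∀ s : AffineGroup K, valuation K s.trans < 1 → valuation K (s.dil : K) = 1 →
      quasiRegularSchwartz s v = v := fun s h1 h2 => Subtype.ext (by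
    change quasiRegular μ s v = v
    rw [hv, quasiRegular_haarWavelet μ p hp _ h1 h2])
  have hsum' : ∀ t : AffineGroup K, ∑ i, quasiRegular μ (t * ⟨ρ i, 1⟩) v = 0 := by
    intro t
    simp only [quasiRegular_mul]
    rw [← quasiRegular_sum, hv, sum_quasiRegular_haarWavelet μ hp hρ]
    exact (quasiRegularLinear μ t).map_zero
  have hsum : ∀ t : AffineGroup K, ∑ i, quasiRegularSchwartz (t * ⟨ρ i, 1⟩) v = 0 := fun t =>
    Subtype.ext ((Submodule.coe_sum _ _ _).trans (hsum' t))
  -- The coefficients `‖v‖²` and `‖L v‖²` are chosen so that this difference of two matrix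
  -- coefficients vanishes at `t = 1`.
  have main : ∀ t : AffineGroup K,
      (‖(v : Lp ℂ 2 μ)‖ ^ 2 : ℂ) * inner ℂ (L v) (L (quasiRegularSchwartz t v)) -
        ‖L v‖ ^ 2 * inner ℂ (v : Lp ℂ 2 μ) (quasiRegular μ t v) = 0 := by
    refine eq_zero_of_hermitian_of_invariant hρ ?_ ?_ ?_ ?_
    · intro s t h1 h2
      have h3 : quasiRegular μ s v = v := congrArg Subtype.val (hfix s h1 h2)
      rw [hmul, quasiRegular_mul]
      congr 2
      · nth_rw 1 [← hfix s h1 h2]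
        rw [hL]
      · nth_rw 1 [← h3]
        rw [inner_quasiRegular]
    · intro t
      rw [map_sub, map_mul, map_mul, inner_conj_symm, inner_conj_symm, map_pow, map_pow,
        Complex.conj_ofReal, Complex.conj_ofReal]
      congr 2
      · rw [← hL t, ← hmul, mul_inv_cancel, hone]
      · rw [← inner_quasiRegular μ t, ← quasiRegular_mul, mul_inv_cancel, quasiRegular_one]
    · intro t
      rw [Finset.sum_sub_distrib, ← Finset.mul_sum, ← Finset.mul_sum, ← inner_sum, ← inner_sum,
        ← map_sum, hsum, hsum', map_zero, inner_zero_right, inner_zero_right, mul_zero, mul_zero, sub_zero]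
    · rw [hone, quasiRegular_one, inner_self_eq_norm_sq_to_K, inner_self_eq_norm_sq_to_K]
      simp [mul_comm]
  have h1 := main (s⁻¹ * t)
  rw [sub_eq_zero] at h1
  rw [← inner_quasiRegular μ s, ← quasiRegular_mul, ← hL s, ← hmul, mul_inv_cancel_left] at h1
  exact h1

end Schur

/-! ### Tight frames in a Hilbert space -/

section TightFrame

/-- Polarization of the frame identity. -/
theorem IsTightFrame.hasSum_inner {ι E : Type*} [NormedAddCommGroup E] [InnerProductSpace ℂ E]
    {v : ι → E} {C : ℝ} (h : IsTightFrame v C) (x y : E) :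
    HasSum (fun i => inner ℂ (inner ℂ (v i) x) (inner ℂ (v i) y)) (C * inner ℂ x y) := by
  have key : ∀ z : E, HasSum (fun i => ((‖(inner ℂ (v i) z : ℂ)‖ : ℂ) ^ 2)) (C * (‖z‖ : ℂ) ^ 2) :=
    fun z => by exact_mod_cast Complex.hasSum_ofReal.2 (h.2 z)
  have h1 := (((key (x + y)).sub (key (x - y))).add
    (((key (x - (RCLike.I : ℂ) • y)).sub (key (x + (RCLike.I : ℂ) • y))).mul_right
      (RCLike.I : ℂ))).div_const 4
  rw [inner_eq_sum_norm_sq_div_four]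
  convert! h1 using 1
  · funext i
    rw [inner_eq_sum_norm_sq_div_four]
    simp only [inner_add_right, inner_sub_right, inner_smul_right, smul_eq_mul]
    rfl
  · have e : ∀ a b c d i : ℂ, (C : ℂ) * ((a - b + (c - d) * i) / 4) =
        (C * a - C * b + (C * c - C * d) * i) / 4 := by
      intros
      ring
    exact e _ _ _ _ _

/-- If only finitely many frame coefficients of `f` are nonzero, the frame reconstruction formula
holds as a finite sum. -/
theorem IsTightFrame.eq_sum_of_finite {ι E : Type*} [NormedAddCommGroup E] [InnerProductSpace ℂ E]
    {v : ι → E} {C : ℝ} (h : IsTightFrame v C) {f : E} {s : Finset ι}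
    (hs : ∀ i ∉ s, inner ℂ (v i) f = (0 : ℂ)) :
    f = ∑ i ∈ s, (C : ℂ)⁻¹ • (inner ℂ (v i) f : ℂ) • v i := by
  have hC : (C : ℂ) ≠ 0 := Complex.ofReal_ne_zero.2 h.1.ne'
  refine ext_inner_left ℂ fun u => ?_
  have h1 := (h.hasSum_inner u f).unique (hasSum_sum_of_ne_finset_zero (s := s) fun i hi => by
    rw [hs i hi, inner_zero_right])
  refine mul_left_cancel₀ hC (h1.trans ?_)
  rw [inner_sum, Finset.mul_sum]
  refine Finset.sum_congr rfl fun i _ => ?_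
  rw [inner_smul_right, inner_smul_right, mul_inv_cancel_left₀ hC, RCLike.inner_apply,
    inner_conj_symm]

end TightFrame

/-! ### Existence of tight frames along cosets -/

section Frame

/-- The quotient by an open subgroup is discrete, so compact subsets of it are finite. -/
theorem IsCompact.finite_image_quotientMk {G : Type*} [Group G] [TopologicalSpace G]
    [ContinuousMul G] {H : Subgroup G} (hH : IsOpen (H : Set G)) {Q : Set G} (hQ : IsCompact Q) :
    ((QuotientGroup.mk : G → G ⧸ H) '' Q).Finite := by
  have := QuotientGroup.discreteTopology hH
  exact (hQ.image QuotientGroup.continuous_mk).finite_of_discrete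

variable {K : Type*} [Field K] [ValuativeRel K] [TopologicalSpace K] [IsNonarchimedeanLocalField K]
variable [MeasurableSpace K] [BorelSpace K] {μ : Measure K} [μ.IsAddHaarMeasure] [μ.Regular]

theorem finite_waveletTransform_ne_zero {g f : Lp ℂ 2 μ} {H : Subgroup (AffineGroup K)}
    (hH : IsOpen (H : Set (AffineGroup K))) (hc : HasCompactSupport (waveletTransform μ g f))
    {ι : Type*} {r : ι → AffineGroup K}
    (hr : Function.Injective fun i => (r i : AffineGroup K ⧸ H)) :
    {i | waveletTransform μ g f (r i) ≠ 0}.Finite := by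
  refine Set.Finite.of_finite_image
    ((IsCompact.finite_image_quotientMk hH hc).subset ?_) hr.injOn
  rintro _ ⟨i, hi, rfl⟩
  exact ⟨r i, subset_tsupport _ hi, rfl⟩

theorem waveletTransform_out {g : Lp ℂ 2 μ} {H : Subgroup (AffineGroup K)}
    (hHg : H ≤ quasiRegularStabilizer g) (f : Lp ℂ 2 μ) (s : AffineGroup K) :
    waveletTransform μ g f (s : AffineGroup K ⧸ H).out = waveletTransform μ g f s := by
  obtain ⟨h, hh⟩ := QuotientGroup.mk_out_eq_mul H s
  rw [hh, waveletTransform_mul_of_mem f s (hHg h.2)]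

theorem waveletTransform_quasiRegular (g f : Lp ℂ 2 μ) (s t : AffineGroup K) :
    waveletTransform μ g (quasiRegular μ s f) t = waveletTransform μ g f (s⁻¹ * t) := by
  rw [waveletTransform, waveletTransform, quasiRegular_mul, inner_quasiRegular_left μ s⁻¹, inv_inv]

/-- The wavelet coefficients with respect to `g ∈ S₀(K)` along the left cosets of an open subgroup,
as a linear map from `S₀(K)` to `ℓ²`. -/
noncomputable def waveletCoefficients {g : Lp ℂ 2 μ} (hg : g ∈ schwartzZero μ)
    {H : Subgroup (AffineGroup K)} (hH : IsOpen (H : Set (AffineGroup K))) :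
    schwartzZeroSubmodule μ →ₗ[ℂ] lp (fun _ : AffineGroup K ⧸ H => ℂ) 2 where
  toFun f := ⟨fun q => waveletTransform μ g f q.out,
    -- Compact support leaves finitely many nonzero coefficients, so square summability is automatic
    -- on `S₀(K)`.
    (memℓp_zero (finite_waveletTransform_ne_zero hH
      (hasCompactSupport_waveletTransform f.2 hg)
      (fun a b h => by simpa using h))).of_exponent_ge (by simp)⟩
  map_add' f f' := by
    ext q
    simp only [waveletTransform, Submodule.coe_add, inner_add_right]
    rfl
  map_smul' c f := by
    ext q
    simp only [waveletTransform, Submodule.coe_smul, inner_smul_right]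
    rfl

theorem waveletCoefficients_apply {g : Lp ℂ 2 μ} (hg : g ∈ schwartzZero μ)
    {H : Subgroup (AffineGroup K)} (hH : IsOpen (H : Set (AffineGroup K)))
    (f : schwartzZeroSubmodule μ) (q : AffineGroup K ⧸ H) :
    waveletCoefficients hg hH f q = waveletTransform μ g f q.out := rfl

/-- The coefficients are independent of coset representatives, so `π(s)` acts on them by permuting
`G ⧸ H`. -/
theorem inner_waveletCoefficients_quasiRegular {g : Lp ℂ 2 μ} (hg : g ∈ schwartzZero μ)
    {H : Subgroup (AffineGroup K)} (hH : IsOpen (H : Set (AffineGroup K)))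
    (hHg : H ≤ quasiRegularStabilizer g) (s : AffineGroup K) (f f' : schwartzZeroSubmodule μ) :
    inner ℂ (waveletCoefficients hg hH (quasiRegularSchwartz s f))
      (waveletCoefficients hg hH (quasiRegularSchwartz s f')) =
    inner ℂ (waveletCoefficients hg hH f) (waveletCoefficients hg hH f') := by
  have key : ∀ (f : schwartzZeroSubmodule μ) (q : AffineGroup K ⧸ H),
      waveletCoefficients hg hH (quasiRegularSchwartz s f) q =
        waveletCoefficients hg hH f (s⁻¹ • q) := by
    intro f q
    obtain ⟨t, rfl⟩ := QuotientGroup.mk_surjective q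
    rw [waveletCoefficients_apply, waveletCoefficients_apply, waveletTransform_out hHg,
      MulAction.Quotient.smul_coe, waveletTransform_out hHg]
    exact waveletTransform_quasiRegular g f s t
  rw [lp.inner_eq_tsum, lp.inner_eq_tsum]
  simp only [key]
  exact (MulAction.toPerm s⁻¹).tsum_eq fun q =>
    inner ℂ (waveletCoefficients hg hH f q) (waveletCoefficients hg hH f' q)

theorem dense_span_quasiRegular_haarWavelet {p : Kˣ}
    (hp : ∀ x : K, valuation K x < 1 ↔ valuation K x ≤ valuation K p)
    {ι : Type*} [Fintype ι] {ρ : ι → K} (hρ : IsResidueSystem ρ) :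
    (Submodule.span ℂ (Set.range fun s =>
      quasiRegular μ s (haarWavelet μ p (Fintype.card ι)))).topologicalClosure = ⊤ := by
  rw [Submodule.topologicalClosure_eq_top_iff, Submodule.eq_bot_iff]
  intro f hf
  exact eq_zero_of_forall_inner_quasiRegular_haarWavelet hp hρ fun s =>
    (Submodule.mem_orthogonal _ _).1 hf _ (Submodule.subset_span ⟨s, rfl⟩)

/-- The wavelet coefficients along the left cosets of an open subgroup fixing `g` form a tight
frame. -/
theorem exists_hasSum_waveletTransform {g : Lp ℂ 2 μ} (hg : g ∈ schwartzZero μ) (hg0 : g ≠ 0)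
    {H : Subgroup (AffineGroup K)} (hH : IsOpen (H : Set (AffineGroup K)))
    (hHg : H ≤ quasiRegularStabilizer g) :
    ∃ C : ℝ, 0 < C ∧ ∀ f : Lp ℂ 2 μ,
      HasSum (fun q : AffineGroup K ⧸ H => ‖waveletTransform μ g f q.out‖ ^ 2) (C * ‖f‖ ^ 2) := by
  obtain ⟨p, hp⟩ := exists_uniformizer (K := K)
  obtain ⟨ι, _, ρ, hρ⟩ := exists_isResidueSystem (K := K)
  set L := waveletCoefficients hg hH with hLdef
  set v : schwartzZeroSubmodule μ :=
    ⟨haarWavelet μ p (Fintype.card ι), haarWavelet_mem_schwartzZero μ hp hρ⟩ with hv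
  -- If the wavelet were zero, every vector, in particular `g`, would be orthogonal to its orbit.
  have hv0 : (v : Lp ℂ 2 μ) ≠ 0 := by
    intro h0
    have h1 : haarWavelet μ p (Fintype.card ι) = 0 := h0
    refine hg0 (eq_zero_of_forall_inner_quasiRegular_haarWavelet hp hρ fun s => ?_)
    have h2 : quasiRegular μ s 0 = 0 := (quasiRegularLinear μ s).map_zero
    rw [h1, h2, inner_zero_left]
  set C : ℝ := ‖L v‖ ^ 2 / ‖(v : Lp ℂ 2 μ)‖ ^ 2 with hC
  have hC0 : 0 ≤ C := by positivity
  set D : Submodule ℂ (schwartzZeroSubmodule μ) :=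
    Submodule.span ℂ (Set.range fun s => quasiRegularSchwartz s v) with hD
  have hinner : ∀ x ∈ D, ∀ y ∈ D, inner ℂ (L x) (L y) = C * inner ℂ (x : Lp ℂ 2 μ) y := by
    intro x hx y hy
    induction hx, hy using Submodule.span_induction₂ with
    | mem_mem x y hx hy =>
      obtain ⟨s, rfl⟩ := hx
      obtain ⟨t, rfl⟩ := hy
      have h1 := inner_map_quasiRegular_haarWavelet
        (inner_waveletCoefficients_quasiRegular hg hH hHg) hp hρ v rfl s t
      have h2 : ((‖(v : Lp ℂ 2 μ)‖ : ℂ)) ^ 2 ≠ 0 := by simpa using hv0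
      rw [hC]
      push_cast
      rw [div_mul_eq_mul_div, eq_div_iff h2, mul_comm]
      exact h1
    | zero_left y hy => simp
    | zero_right x hx => simp
    | add_left x y z hx hy hz h1 h2 =>
      simp only [map_add, Submodule.coe_add, inner_add_left, h1, h2, mul_add]
    | add_right x y z hx hy hz h1 h2 =>
      simp only [map_add, Submodule.coe_add, inner_add_right, h1, h2, mul_add]
    | smul_left r x y hx hy h1 =>
      simp only [map_smul, Submodule.coe_smul, inner_smul_left, h1, mul_left_comm]
    | smul_right r x y hx hy h1 =>
      simp only [map_smul, Submodule.coe_smul, inner_smul_right, h1, mul_left_comm]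
  have hnorm : ∀ x ∈ D, ‖L x‖ ^ 2 = C * ‖(x : Lp ℂ 2 μ)‖ ^ 2 := by
    intro x hx
    have h1 := hinner x hx x hx
    rw [inner_self_eq_norm_sq_to_K, inner_self_eq_norm_sq_to_K] at h1
    refine Complex.ofReal_injective ?_
    push_cast
    exact h1
  have hnorm' : ∀ x ∈ D, ‖L x‖ = √C * ‖(x : Lp ℂ 2 μ)‖ := by
    intro x hx
    rw [← Real.sqrt_sq (norm_nonneg (L x)), hnorm x hx, Real.sqrt_mul hC0,
      Real.sqrt_sq (norm_nonneg _)]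
  have hsum : ∀ f : Lp ℂ 2 μ, HasSum
      (fun q : AffineGroup K ⧸ H => ‖waveletTransform μ g f q.out‖ ^ 2) (C * ‖f‖ ^ 2) := by
    intro f
    -- On `D` the map `L` is `√C` times an isometry. Approximating `f` from `D` gives a Cauchy
    -- sequence in `ℓ²`, whose limit has the wavelet coefficients of `f` as coordinates.
    have hdense : f ∈ closure ((fun x : schwartzZeroSubmodule μ => (x : Lp ℂ 2 μ)) '' D) := by
      have h1 : (D.map (schwartzZeroSubmodule μ).subtype).topologicalClosure = ⊤ := by
        rw [hD, Submodule.map_span, ← Set.range_comp]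
        exact dense_span_quasiRegular_haarWavelet hp hρ
      have h2 : f ∈ (D.map (schwartzZeroSubmodule μ).subtype).topologicalClosure := by
        rw [h1]; trivial
      exact h2
    obtain ⟨u, hu, hlim⟩ := mem_closure_iff_seq_limit.1 hdense
    choose w hwD hw using hu
    have hcauchy : CauchySeq fun n => L (w n) := by
      have h1 := hlim.cauchySeq
      rw [Metric.cauchySeq_iff] at h1 ⊢
      intro ε hε
      -- The summand `1` avoids division by zero, as `C > 0` is not yet known.
      obtain ⟨N, hN⟩ := h1 (ε / (√C + 1)) (by positivity)
      refine ⟨N, fun m hm n hn => ?_⟩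
      have h2 := hN m hm n hn
      rw [dist_eq_norm, ← hw m, ← hw n] at h2
      rw [dist_eq_norm, ← map_sub, hnorm' _ (D.sub_mem (hwD m) (hwD n))]
      rw [lt_div_iff₀ (by positivity)] at h2
      refine lt_of_le_of_lt ?_ h2
      rw [mul_comm]
      exact mul_le_mul_of_nonneg_left (by linarith) (norm_nonneg _)
    obtain ⟨l, hl⟩ := cauchySeq_tendsto_of_complete hcauchy
    have hlim' : Filter.Tendsto (fun n => (w n : Lp ℂ 2 μ)) Filter.atTop (𝓝 f) := by
      simpa only [hw] using hlim
    have hcoord : ∀ q : AffineGroup K ⧸ H, l q = waveletTransform μ g f q.out := by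
      intro q
      have h1 : Filter.Tendsto (fun n => L (w n) q) Filter.atTop (𝓝 (l q)) := by
        rw [tendsto_iff_norm_sub_tendsto_zero] at hl ⊢
        refine squeeze_zero (fun _ => norm_nonneg _) (fun n => ?_) hl
        exact lp.norm_apply_le_norm (by simp) (L (w n) - l) q
      have h2 : Filter.Tendsto (fun n => L (w n) q) Filter.atTop
          (𝓝 (waveletTransform μ g f q.out)) :=
        tendsto_const_nhds.inner hlim'
      exact tendsto_nhds_unique h1 h2
    have hnl : ‖l‖ ^ 2 = C * ‖f‖ ^ 2 := by
      refine tendsto_nhds_unique (hl.norm.pow 2) ?_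
      simp only [hnorm _ (hwD _)]
      exact (hlim'.norm.pow 2).const_mul C
    have h3 := lp.hasSum_norm (by simp) l
    simp only [hcoord, ENNReal.toReal_ofNat, Real.rpow_ofNat, hnl] at h3
    exact h3
  -- If `C` were zero, the coefficient of `g` at the trivial coset, which is `⟨g | g⟩`, would
  -- vanish.
  refine ⟨C, hC0.lt_of_ne' fun h0 => ?_, hsum⟩
  have h1 := hsum g
  rw [h0, zero_mul, hasSum_zero_iff_of_nonneg fun _ => by positivity] at h1
  have h2 := congrFun h1 ((1 : AffineGroup K) : AffineGroup K ⧸ H)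
  simp only [waveletTransform_out hHg, Pi.zero_apply] at h2
  rw [waveletTransform, quasiRegular_one] at h2
  exact hg0 (by simpa using h2)

/-- A wavelet in `S₀(K)` generates a tight frame along the left cosets of some compact open
subgroup. -/
theorem exists_isTightFrame {g : Lp ℂ 2 μ} (hg : g ∈ schwartzZero μ) (hg0 : g ≠ 0) :
    ∃ (H : Subgroup (AffineGroup K)) (R : Set (AffineGroup K)) (C : ℝ),
      IsOpen (H : Set (AffineGroup K)) ∧ IsCompact (H : Set (AffineGroup K)) ∧
      Subgroup.IsComplement R (H : Set (AffineGroup K)) ∧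
      IsTightFrame (fun r : R => quasiRegular μ r g) C := by
  -- The first factor makes `H` compact, the second makes the coefficients well defined on cosets.
  set H := AffineGroup.integral K ⊓ quasiRegularStabilizer g
  have hH : IsOpen (H : Set (AffineGroup K)) :=
    AffineGroup.isOpen_integral.inter (isOpen_quasiRegularStabilizer hg)
  have hHg : H ≤ quasiRegularStabilizer g := inf_le_right
  obtain ⟨R, hR, -⟩ := H.exists_isComplement_left 1
  obtain ⟨C, hC, hsum⟩ := exists_hasSum_waveletTransform hg hg0 hH hHg
  refine ⟨H, R, C, hH, AffineGroup.isCompact_integral.of_isClosed_subset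
    (H.isClosed_of_isOpen hH) Set.inter_subset_left, hR, hC, fun f => ?_⟩
  rw [← hR.leftQuotientEquiv.hasSum_iff]
  convert hsum f using 2 with q
  have h1 : ((hR.leftQuotientEquiv q : AffineGroup K) : AffineGroup K ⧸ H) = q :=
    hR.quotientGroupMk_leftQuotientEquiv q
  nth_rw 2 [← h1]
  rw [waveletTransform_out hHg]
  rfl

end Frame

/-! ### The equivalences -/

theorem corollary6p4 {K : Type*} [Field K] [ValuativeRel K] [TopologicalSpace K]
    [IsNonarchimedeanLocalField K] [MeasurableSpace K] [BorelSpace K]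
    (μ : Measure K) [μ.IsAddHaarMeasure] [μ.Regular]
    (g : Lp ℂ 2 μ) (hg : g ∈ schwartzZero μ) (hg0 : g ≠ 0) (f : Lp ℂ 2 μ) :
    List.TFAE [
      f ∈ schwartzZero μ,
      Continuous (waveletTransform μ g f) ∧ HasCompactSupport (waveletTransform μ g f),
      ∀ (H : Subgroup (AffineGroup K)) (R : Set (AffineGroup K)) (C : ℝ),
        IsOpen (H : Set (AffineGroup K)) → IsCompact (H : Set (AffineGroup K)) →
        Subgroup.IsComplement R (H : Set (AffineGroup K)) →
        IsTightFrame (fun r : R => quasiRegular μ r g) C →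
        {r : R | (C : ℂ)⁻¹ • waveletTransform μ g f r • quasiRegular μ (r : AffineGroup K) g
          ≠ 0}.Finite] := by
  tfae_have 1 → 2 := fun hf =>
    ⟨continuous_waveletTransform hg f, hasCompactSupport_waveletTransform hf hg⟩
  tfae_have 2 → 3 := by
    rintro ⟨-, hc⟩ H R C hH - hR -
    refine (finite_waveletTransform_ne_zero hH hc (r := fun r : R => (r : AffineGroup K))
      (Subgroup.isComplement_subgroup_right_iff_bijective.1 hR).injective).subset ?_
    intro r hr h0
    exact hr (by rw [h0, zero_smul, smul_zero])
  tfae_have 3 → 1 := by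
    intro h
    -- A single tight frame suffices: its finite expansion places `f` in the `π`-invariant subspace
    -- `S₀(K)`.
    obtain ⟨H, R, C, hH, hHc, hR, hframe⟩ := exists_isTightFrame hg hg0
    have hfin := h H R C hH hHc hR hframe
    have hC : (C : ℂ)⁻¹ ≠ 0 := inv_ne_zero (Complex.ofReal_ne_zero.2 hframe.1.ne')
    have hzero : ∀ r ∉ hfin.toFinset, inner ℂ (quasiRegular μ (r : AffineGroup K) g) f = (0 : ℂ) := by
      intro r hr
      simp only [Set.Finite.mem_toFinset, Set.mem_ofPred_eq, not_not, smul_eq_zero, hC,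
        false_or] at hr
      rcases hr with hr | hr
      · exact hr
      · rw [hr, inner_zero_left]
    rw [hframe.eq_sum_of_finite hzero]
    refine (schwartzZeroSubmodule μ).sum_mem fun r _ => ?_
    exact (schwartzZeroSubmodule μ).smul_mem _ ((schwartzZeroSubmodule μ).smul_mem _
      (quasiRegular_mem_schwartzZero _ hg))
  tfae_finish
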